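/- Let $n,r\ge 0$ be integers, let $x_1,\dots,x_n\in\mathbb{C}$ be distinct, and let $Q$ be the star-shaped quiver with a central vertex of dimension $r$ and $n$ legs, the $m$-th leg having vertices of dimensions $\gamma^m_1,\gamma^m_2,\dots,\gamma^m_{l_m}$ (arbitrary natural numbers, $l_m\ge 0$) numbered outwards from the centre, with all arrows pointing towards the centre. Let $\mathbf{v}$ be this dimension vector and $GL(\mathbf v)=\prod_i GL_{\mathbf v_i}(\mathbb C)$. Let $\overline Q$ be the doubled quiver. A point $\mathsf V$ of $\mathrm{Rep}(\overline Q,\mathbf v)=T^*\mathrm{Rep}(Q,\mathbf v)$ consists of linear maps $g^m_j$ along the arrows of $Q$ and $f^m_j$ along the opposite arrows. In particular $\mathbb{C}^r\xrightarrow{f^m_1}\mathbb{C}^{\gamma^m_1}\xrightarrow{g^m_1}\mathbb{C}^r$. The space carries the canonical Poisson bracket $$\{F,G\}=\sum_{e}\sum_{a,b}\Big(\frac{\partial G}{\partial (g_e)_{ab}}\frac{\partial F}{\partial (f_e)_{ba}}-\frac{\partial F}{\partial (g_e)_{ab}}\frac{\partial G}{\partial (f_e)_{ba}}\Big),$$ where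 $e$ runs over the arrows of $Q$, and the moment map $\mu$ whose component at a vertex $i$ is $\sum_{e\text{ to }i}g_ef_e-\sum_{e\text{ from }i}f_eg_e$. Put $\phi^m=g^m_1f^m_1$ (and $\phi^m=0$ if the $m$-th leg is empty), $\phi_{\mathsf V}(z)=\sum_{m=1}^n\frac{\phi^m}{z-x_m}$ and $I_t(z)=\mathrm{Tr}\big(\phi_{\mathsf V}(z)^t\big)$ for $t\ge 0$. Then for all $t,t'\ge 0$ $$\{I_t(z),I_{t'}(w)\}=0,$$ both as an identity in which $z,w$ are independent variables (the bracket being extended bilinearly over rational functions of $z$ and of $w$) and for all complex numbers $z,w\notin\{x_1,\dots,x_n\}$. Let $\mu^{-1}(0)$ denote the scheme-theoretic fibre. For a character $\chi$ of $GL(\mathbf v)$, given by $\chi(g)=\prod_i\det(g_i)^{\theta_i}$ with $\theta_i\in\mathbb{Z}$, let $$\mathfrak M_\chi(\mathbf v)=\mathrm{Proj}\bigoplus_{k\ge0}\mathbb{C}[\mu^{-1}(0)]^{GL(\mathbf v),\chi^k},\qquad \mathfrak M_0(\mathbf v)=\mathrm{Spec}\,\mathbb{C}[\mu^{-1}(0)]^{GL(\mathbf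 v)},\qquad \pi:\mathfrak M_\chi(\mathbf v)\to\mathfrak M_0(\mathbf v),$$ where $\mathbb{C}[\mu^{-1}(0)]^{GL(\mathbf v),\chi^k}$ is the space of $f$ with $f(g^{-1}\mathsf V)=\chi(g)^kf(\mathsf V)$. Both quotients carry the Poisson bracket induced from that of $\mathrm{Rep}(\overline Q,\mathbf v)$: one computes the bracket on lifts to $\mathbb{C}[\mathrm{Rep}(\overline Q,\mathbf v)]$, by the quotient rule for fractions of semi-invariants, and restricts to $\mu^{-1}(0)$. Let $\tilde h_Q$ be the map sending $\mathsf V$ to $(\alpha_1,\dots,\alpha_r)$, where $\alpha_j=(-1)^j\,\mathrm{Tr}\big(\wedge^j\phi_{\mathsf V}(z)\big)(dz)^j$ are the coefficients of the characteristic polynomial of $\phi_{\mathsf V}(z)\,dz$. Let $h_Q^0:\mathfrak M_0(\mathbf v)\to\mathbb{C}(z)^r$ be the descent of $\tilde h_Q|_{\mu^{-1}(0)}$ and $h_Q=h_Q^0\circ\pi$. A component of one of these maps is its composition with a $\mathbb{C}$-linear functional on $\mathbb{C}(z)^r$, where the factors $(dz)^j$ are dropped; so all linear coordinates of the Hitchin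 base $\mathbf H_P\subset\mathbb{C}(z)^r$ are included. Then: * any two components of $\tilde h_Q$ Poisson commute on $\mathrm{Rep}(\overline Q,\mathbf v)$, and for any functions $F,G$ on $\mathrm{Rep}(\overline Q,\mathbf v)$ that agree on $\mu^{-1}(0)$ with two components of $\tilde h_Q$, the bracket $\{F,G\}$ vanishes on $\mu^{-1}(0)$; * for every character $\chi$, any two components of $h_Q$ Poisson commute on $\mathfrak M_\chi(\mathbf v)$; * any two components of $h_Q^0$ Poisson commute on $\mathfrak M_0(\mathbf v)$. -/

import Mathlib

noncomputable section

namespace QuiverVariety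

open MvPolynomial Matrix

/-- A finite quiver (vertices, arrows, source, target) together with a dimension vector `v`. -/
structure DimQuiver where
  Vert : Type
  Arr : Type
  [fintypeVert : Fintype Vert]
  [decEqVert : DecidableEq Vert]
  [fintypeArr : Fintype Arr]
  [decEqArr : DecidableEq Arr]
  src : Arr → Vert
  tgt : Arr → Vert
  dim : Vert → ℕ

attribute [instance] DimQuiver.fintypeVert DimQuiver.decEqVert DimQuiver.fintypeArr
  DimQuiver.decEqArr

variable (Q : DimQuiver)

/-- Linear coordinates on `Rep(Q, v)`: the `(a, b)` entry of the matrix of the arrow `e`. -/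
abbrev Coord : Type := Σ e : Q.Arr, Fin (Q.dim (Q.tgt e)) × Fin (Q.dim (Q.src e))

/-- The coordinate ring of `Rep(Q̄, v) = T^* Rep(Q, v)`, where `Q̄` is the doubled quiver.
For `c = ⟨e, (a, b)⟩` the variable `inl c` is the `(a, b)` entry of the map attached to the arrow
`e : src e → tgt e`, and `inr c` is the dual coordinate under the trace pairing
`Hom(V₁, V₂) × Hom(V₂, V₁) → ℂ`, i.e. the `(b, a)` entry of the map attached to the reversed
arrow `tgt e → src e`. -/
abbrev CoordRing : Type := MvPolynomial (Coord Q ⊕ Coord Q) ℂ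

/-- The generic matrix of the arrow `e` of `Q`. -/
def fwd (e : Q.Arr) : Matrix (Fin (Q.dim (Q.tgt e))) (Fin (Q.dim (Q.src e))) (CoordRing Q) :=
  Matrix.of fun a b => X (Sum.inl ⟨e, a, b⟩)

/-- The generic matrix of the arrow reversed to `e`. -/
def bwd (e : Q.Arr) : Matrix (Fin (Q.dim (Q.src e))) (Fin (Q.dim (Q.tgt e))) (CoordRing Q) :=
  Matrix.of fun b a => X (Sum.inr ⟨e, a, b⟩)

variable {Q}

/-- The canonical Poisson bracket on `ℂ[T^* Rep(Q, v)]`: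
`{F, G} = ∑ (∂G/∂p ∂F/∂q - ∂F/∂p ∂G/∂q)`, where `p` runs over the coordinates of `Rep(Q, v)` and
`q` is the dual coordinate of `p`. -/
def bracket (F G : CoordRing Q) : CoordRing Q :=
  ∑ c : Coord Q, (pderiv (Sum.inl c) G * pderiv (Sum.inr c) F
    - pderiv (Sum.inl c) F * pderiv (Sum.inr c) G)

variable (Q)
/-- The moment map `μ(f, g) = ∑ (f ∘ g - g ∘ f)`, sum over the arrows, with values in
`∏ i, gl(v i)`. -/
def moment : (i : Q.Vert) → Matrix (Fin (Q.dim i)) (Fin (Q.dim i)) (CoordRing Q) :=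
  ∑ e : Q.Arr, (Pi.single (Q.tgt e) (fwd Q e * bwd Q e) - Pi.single (Q.src e) (bwd Q e * fwd Q e))

/-- The ideal of `μ⁻¹(0)`, generated by the matrix entries of `μ`. -/
def momentIdeal : Ideal (CoordRing Q) :=
  Ideal.span {F | ∃ i a b, F = moment Q i a b}

/-- The coordinate ring `ℂ[μ⁻¹(0)]`. -/
abbrev FibreRing : Type := CoordRing Q ⧸ momentIdeal Q

/-- The group `GL(v) = ∏ i, GL(v i)`. -/
abbrev Gauge : Type := (i : Q.Vert) → GL (Fin (Q.dim i)) ℂ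

/-- A constant matrix, with entries regarded as constant functions. -/
abbrev cst {m n : Type} (M : Matrix m n ℂ) : Matrix m n (CoordRing Q) :=
  M.map (C : ℂ →+* CoordRing Q)

variable {Q}

/-- The pullback of functions along the action `V ↦ g · V` of `GL(v)` on `Rep(Q̄, v)`,
i.e. `(pull g F)(V) = F(g · V)`; the map of an arrow `i → j` is acted on by `φ ↦ g_j φ g_i⁻¹`. -/
def pull (g : Gauge Q) : CoordRing Q →ₐ[ℂ] CoordRing Q :=
  aeval (Sum.elim
    (fun c => ((cst Q (g (Q.tgt c.1)).1 * fwd Q c.1 * cst Q (g (Q.src c.1))⁻¹.1 :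
      Matrix _ _ (CoordRing Q)) c.2.1 c.2.2))
    (fun c => ((cst Q (g (Q.src c.1)).1 * bwd Q c.1 * cst Q (g (Q.tgt c.1))⁻¹.1 :
      Matrix _ _ (CoordRing Q)) c.2.2 c.2.1)))

/-! ### The bracket is a `GL(v)`-equivariant biderivation -/

/-- The derivation `F ↦ {F, G}`. -/
def ham (G : CoordRing Q) : Derivation ℂ (CoordRing Q) (CoordRing Q) :=
  ∑ c : Coord Q, ((pderiv (Sum.inl c) G) • pderiv (Sum.inr c)
    - (pderiv (Sum.inr c) G) • pderiv (Sum.inl c))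

lemma ham_apply (F G : CoordRing Q) : ham G F = bracket F G := by
  have h : ham G F = Derivation.coeFnAddMonoidHom (ham G) F := rfl
  rw [h, ham, map_sum, Finset.sum_apply, bracket]
  refine Finset.sum_congr rfl fun c _ => ?_
  simp [Derivation.coeFnAddMonoidHom]
  ring

lemma bracket_skew (F G : CoordRing Q) : bracket F G = - bracket G F := by
  simp only [bracket, ← Finset.sum_neg_distrib]
  exact Finset.sum_congr rfl fun c _ => by ring

lemma pull_fwd (g : Gauge Q) (e : Q.Arr) : (fwd Q e).map (pull g) =
    cst Q (g (Q.tgt e)).1 * fwd Q e * cst Q (g (Q.src e))⁻¹.1 := by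
  ext a b
  simp [pull, fwd]

lemma pull_bwd (g : Gauge Q) (e : Q.Arr) : (bwd Q e).map (pull g) =
    cst Q (g (Q.src e)).1 * bwd Q e * cst Q (g (Q.tgt e))⁻¹.1 := by
  ext a b
  simp [pull, bwd]

lemma cst_inv_mul {i : ℕ} (g : GL (Fin i) ℂ) :
    (cst Q (g⁻¹).1 * cst Q g.1 : Matrix _ _ (CoordRing Q)) = 1 := by
  rw [← Matrix.map_mul, ← Units.val_mul]
  simp only [inv_mul_cancel, Units.val_one]
  exact Matrix.map_one _ (map_zero _) (map_one _)
lemma cst_mul_inv {i : ℕ} (g : GL (Fin i) ℂ) :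
    (cst Q g.1 * cst Q (g⁻¹).1 : Matrix _ _ (CoordRing Q)) = 1 := by
  rw [← Matrix.map_mul, ← Units.val_mul]
  simp only [mul_inv_cancel, Units.val_one]
  exact Matrix.map_one _ (map_zero _) (map_one _)

lemma pull_moment (g : Gauge Q) (i : Q.Vert) : (moment Q i).map (pull g) =
    cst Q (g i).1 * moment Q i * cst Q (g i)⁻¹.1 := by
  let f1 : (i : Q.Vert) → Matrix (Fin (Q.dim i)) (Fin (Q.dim i)) (CoordRing Q) →+
      Matrix (Fin (Q.dim i)) (Fin (Q.dim i)) (CoordRing Q) :=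
    fun i => (pull g).toRingHom.toAddMonoidHom.mapMatrix
  let f2 : (i : Q.Vert) → Matrix (Fin (Q.dim i)) (Fin (Q.dim i)) (CoordRing Q) →+
      Matrix (Fin (Q.dim i)) (Fin (Q.dim i)) (CoordRing Q) :=
    fun i => (AddMonoidHom.mulRight (cst Q (g i)⁻¹.1)).comp (AddMonoidHom.mulLeft (cst Q (g i).1))
  have key : f1 i (moment Q i) = f2 i (moment Q i) := by
    simp only [moment, Finset.sum_apply, map_sum, Pi.sub_apply, map_sub]
    refine Finset.sum_congr rfl fun e _ => ?_
    rw [Pi.apply_single (fun i => f1 i) (fun i => map_zero _),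
      Pi.apply_single (fun i => f1 i) (fun i => map_zero _),
      Pi.apply_single (fun i => f2 i) (fun i => map_zero _),
      Pi.apply_single (fun i => f2 i) (fun i => map_zero _)]
    have h1 : f1 (Q.tgt e) (fwd Q e * bwd Q e) = f2 (Q.tgt e) (fwd Q e * bwd Q e) := by
      change (fwd Q e * bwd Q e).map (pull g).toRingHom = cst Q _ * (fwd Q e * bwd Q e) * cst Q _
      rw [Matrix.map_mul]
      change (fwd Q e).map (pull g) * (bwd Q e).map (pull g) = _
      rw [pull_fwd, pull_bwd]
      simp only [Matrix.mul_assoc]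
      rw [← Matrix.mul_assoc (cst Q _) (cst Q _), cst_inv_mul, Matrix.one_mul]
    have h2 : f1 (Q.src e) (bwd Q e * fwd Q e) = f2 (Q.src e) (bwd Q e * fwd Q e) := by
      change (bwd Q e * fwd Q e).map (pull g).toRingHom = cst Q _ * (bwd Q e * fwd Q e) * cst Q _
      rw [Matrix.map_mul]
      change (bwd Q e).map (pull g) * (fwd Q e).map (pull g) = _
      rw [pull_fwd, pull_bwd]
      simp only [Matrix.mul_assoc]
      rw [← Matrix.mul_assoc (cst Q _) (cst Q _), cst_inv_mul, Matrix.one_mul]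
    rw [h1, h2]
  exact key

lemma pull_momentIdeal (g : Gauge Q) :
    momentIdeal Q ≤ (momentIdeal Q).comap (pull g) := by
  refine Ideal.span_le.2 ?_
  rintro _ ⟨i, a, b, rfl⟩
  have h : pull g (moment Q i a b) = (cst Q (g i).1 * moment Q i * cst Q (g i)⁻¹.1) a b := by
    rw [← pull_moment]; rfl
  change pull g (moment Q i a b) ∈ momentIdeal Q
  rw [h, Matrix.mul_apply]
  refine Ideal.sum_mem _ fun c _ => Ideal.mul_mem_right _ _ ?_
  rw [Matrix.mul_apply]
  exact Ideal.sum_mem _ fun d _ => Ideal.mul_mem_left _ _ (Ideal.subset_span ⟨i, d, c, rfl⟩)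


lemma bracket_add_left (F F' G : CoordRing Q) :
    bracket (F + F') G = bracket F G + bracket F' G := by
  simp only [← ham_apply, map_add]
lemma bracket_mul_left (F F' G : CoordRing Q) :
    bracket (F * F') G = F * bracket F' G + F' * bracket F G := by
  simp only [← ham_apply, Derivation.leibniz, smul_eq_mul]
lemma bracket_C_left (c : ℂ) (G : CoordRing Q) : bracket (C c) G = 0 := by
  rw [← ham_apply, ← MvPolynomial.algebraMap_eq]; exact Derivation.map_algebraMap _ _
lemma bracket_smul_left (c : ℂ) (F G : CoordRing Q) : bracket (c • F) G = c • bracket F G := by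
  simp only [← ham_apply, Derivation.map_smul]
lemma bracket_add_right (F G G' : CoordRing Q) :
    bracket F (G + G') = bracket F G + bracket F G' := by
  rw [bracket_skew, bracket_add_left, bracket_skew G, bracket_skew G']; ring
lemma bracket_mul_right (F G G' : CoordRing Q) :
    bracket F (G * G') = G * bracket F G' + G' * bracket F G := by
  rw [bracket_skew, bracket_mul_left, bracket_skew G, bracket_skew G']; ring
lemma bracket_C_right (c : ℂ) (F : CoordRing Q) : bracket F (C c) = 0 := by
  rw [bracket_skew, bracket_C_left, neg_zero]
lemma bracket_smul_right (c : ℂ) (F G : CoordRing Q) : bracket F (c • G) = c • bracket F G := by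
  rw [bracket_skew, bracket_smul_left, bracket_skew G]; simp
lemma bracket_sum_left {ι : Type} (s : Finset ι) (F : ι → CoordRing Q) (G : CoordRing Q) :
    bracket (∑ i ∈ s, F i) G = ∑ i ∈ s, bracket (F i) G := by
  simp only [← ham_apply, map_sum]
lemma bracket_sum_right {ι : Type} (s : Finset ι) (F : CoordRing Q) (G : ι → CoordRing Q) :
    bracket F (∑ i ∈ s, G i) = ∑ i ∈ s, bracket F (G i) := by
  rw [bracket_skew, bracket_sum_left, ← Finset.sum_neg_distrib]
  exact Finset.sum_congr rfl fun i _ => (bracket_skew _ _).symm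

lemma bracket_X_inl (F : CoordRing Q) (c : Coord Q) :
    bracket F (X (Sum.inl c)) = pderiv (Sum.inr c) F := by
  simp [bracket, pderiv_X, Pi.single_apply, Finset.sum_ite_eq]
lemma bracket_X_inr (F : CoordRing Q) (c : Coord Q) :
    bracket F (X (Sum.inr c)) = - pderiv (Sum.inl c) F := by
  simp [bracket, pderiv_X, Pi.single_apply, Finset.sum_ite_eq]

lemma bracket_inr_inl (e : Q.Arr) (a b c d) :
    bracket (X (Sum.inr ⟨e, a, b⟩) : CoordRing Q) (X (Sum.inl ⟨e, c, d⟩)) =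
      if a = c ∧ b = d then 1 else 0 := by
  rw [bracket_X_inl, pderiv_X, Pi.single_apply]
  simp

lemma pull_inl (g : Gauge Q) (e : Q.Arr) (a b) : pull g (X (Sum.inl ⟨e, a, b⟩)) =
    ∑ b', ∑ a', ((g (Q.tgt e)).1 a a' * (g (Q.src e))⁻¹.1 b' b) • X (Sum.inl ⟨e, a', b'⟩) := by
  simp [pull, Matrix.mul_apply, Finset.sum_mul, fwd, MvPolynomial.smul_eq_C_mul]
  refine Finset.sum_congr rfl fun _ _ => Finset.sum_congr rfl fun _ _ => by ring
lemma pull_inr (g : Gauge Q) (e : Q.Arr) (a b) : pull g (X (Sum.inr ⟨e, a, b⟩)) =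
    ∑ a', ∑ b', ((g (Q.src e)).1 b b' * (g (Q.tgt e))⁻¹.1 a' a) • X (Sum.inr ⟨e, a', b'⟩) := by
  simp [pull, Matrix.mul_apply, Finset.sum_mul, bwd, MvPolynomial.smul_eq_C_mul]
  refine Finset.sum_congr rfl fun _ _ => Finset.sum_congr rfl fun _ _ => by ring

lemma pull_bracket_X (g : Gauge Q) (c d : Coord Q ⊕ Coord Q) :
    pull g (bracket (X c) (X d)) = bracket (pull g (X c)) (pull g (X d)) := by
  have key : ∀ c d : Coord Q, pull g (bracket (X (Sum.inr c)) (X (Sum.inl d))) =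
      bracket (pull g (X (Sum.inr c))) (pull g (X (Sum.inl d))) := by
    rintro ⟨e, a, b⟩ ⟨e', a', b'⟩
    rw [pull_inl, pull_inr]
    by_cases h : e = e'
    · subst h
      simp only [bracket_sum_left, bracket_sum_right, bracket_smul_left, bracket_smul_right,
        bracket_inr_inl]
      have h1 : ((g (Q.src e)).1 * (g (Q.src e))⁻¹.1) b b' = if b = b' then 1 else 0 := by
        rw [← Units.val_mul]; simp [Matrix.one_apply]
      have h2 : ((g (Q.tgt e)).1 * (g (Q.tgt e))⁻¹.1) a' a = if a = a' then 1 else 0 := by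
        rw [← Units.val_mul]; simp [Matrix.one_apply, eq_comm (a := a)]
      rw [Matrix.mul_apply] at h1 h2
      trans C ((if b = b' then 1 else 0) * (if a = a' then 1 else 0))
      · by_cases h3 : a = a' <;> by_cases h4 : b = b' <;> simp [h3, h4]
      · rw [← h1, ← h2, Finset.sum_mul_sum]
        simp only [map_sum]
        refine Finset.sum_congr rfl fun u _ => ?_
        refine Finset.sum_congr rfl fun v _ => ?_
        simp [ite_and, MvPolynomial.smul_eq_C_mul]
        ring
    · simp only [bracket_sum_left, bracket_sum_right, bracket_smul_left, bracket_smul_right]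
      have : ∀ a b a' b', bracket (X (Sum.inr ⟨e, a, b⟩) : CoordRing Q)
          (X (Sum.inl ⟨e', a', b'⟩)) = 0 := by
        intro a b a' b'
        rw [bracket_X_inl, pderiv_X, Pi.single_apply, if_neg]
        simp only [Sum.inr.injEq, Sigma.mk.injEq, not_and]
        intro h'; exact absurd h'.symm (fun h'' => h h''.symm)
      simp [this]
  have hll : ∀ c d : Coord Q, bracket (X (Sum.inl c) : CoordRing Q) (X (Sum.inl d)) = 0 := by
    intro c d; rw [bracket_X_inl, pderiv_X]; simp
  have hrr : ∀ c d : Coord Q, bracket (X (Sum.inr c) : CoordRing Q) (X (Sum.inr d)) = 0 := by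
    intro c d; rw [bracket_X_inr, pderiv_X]; simp
  rcases c with c | c <;> rcases d with d | d
  · rw [hll]
    obtain ⟨e, a, b⟩ := c
    obtain ⟨e', a', b'⟩ := d
    rw [pull_inl, pull_inl]
    simp [bracket_sum_left, bracket_sum_right, bracket_smul_left, bracket_smul_right, hll]
  · rw [bracket_skew, map_neg, key, bracket_skew]; simp
  · exact key _ _
  · rw [hrr]
    obtain ⟨e, a, b⟩ := c
    obtain ⟨e', a', b'⟩ := d
    rw [pull_inr, pull_inr]
    simp [bracket_sum_left, bracket_sum_right, bracket_smul_left, bracket_smul_right, hrr]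

lemma pull_bracket (g : Gauge Q) (F G : CoordRing Q) :
    pull g (bracket F G) = bracket (pull g F) (pull g G) := by
  have h1 : ∀ c, ∀ G : CoordRing Q,
      pull g (bracket (X c) G) = bracket (pull g (X c)) (pull g G) := by
    intro c G
    induction G using MvPolynomial.induction_on with
    | C a => rw [bracket_C_right, map_zero, ← MvPolynomial.algebraMap_eq, AlgHom.commutes,
        MvPolynomial.algebraMap_eq, bracket_C_right]
    | add p q hp hq => simp only [bracket_add_right, map_add, hp, hq]
    | mul_X p d hp => simp only [bracket_mul_right, map_add, map_mul, hp, pull_bracket_X]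
  induction F using MvPolynomial.induction_on with
  | C a => rw [bracket_C_left, map_zero, ← MvPolynomial.algebraMap_eq, AlgHom.commutes,
      MvPolynomial.algebraMap_eq, bracket_C_left]
  | add p q hp hq => simp only [bracket_add_left, map_add, hp, hq]
  | mul_X p d hp => simp only [bracket_mul_left, map_add, map_mul, hp, h1]

/-! ### The moment map generates the infinitesimal action -/

/-- `HD p p'`: the curve `p`, with values in a finite-dimensional space of functions,
has derivative `p'` at `0`. -/
inductive HD : (ℂ → CoordRing Q) → CoordRing Q → Prop
  | smul (f : ℂ → ℂ) (f' : ℂ) (a : CoordRing Q) (h : HasDerivAt f f' 0) :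
      HD (fun s => f s • a) (f' • a)
  | add (p q : ℂ → CoordRing Q) (p' q' : CoordRing Q) : HD p p' → HD q q' →
      HD (fun s => p s + q s) (p' + q')

lemma HD.mul {p q : ℂ → CoordRing Q} {p' q' : CoordRing Q} (hp : HD p p') (hq : HD q q') :
    HD (fun s => p s * q s) (p' * q 0 + p 0 * q') := by
  induction hp with
  | smul f f' a h =>
    induction hq with
    | smul k k' b h2 =>
      convert HD.smul (fun s => f s * k s) _ (a * b) (h.mul h2) using 1
      · funext s; simp only [smul_mul_smul_comm]
      · simp only [smul_mul_smul_comm, add_smul]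
    | add p q p' q' _ _ hp hq =>
      convert HD.add _ _ _ _ hp hq using 1
      · funext s; ring
      · ring
  | add p q p' q' _ _ hp hq =>
    convert HD.add _ _ _ _ hp hq using 1
    · funext s; ring
    · ring

lemma HD.const (a : CoordRing Q) : HD (fun _ => a) 0 := by
  convert HD.smul (fun _ => 1) 0 a (hasDerivAt_const _ _) using 1
  · simp
  · simp

lemma HD.sum {ι : Type} (s : Finset ι) (p : ι → ℂ → CoordRing Q) (p' : ι → CoordRing Q)
    (h : ∀ i ∈ s, HD (p i) (p' i)) : HD (fun t => ∑ i ∈ s, p i t) (∑ i ∈ s, p' i) := by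
  classical
  induction s using Finset.induction_on with
  | empty => simpa using HD.const (0 : CoordRing Q)
  | insert i s hi ih =>
    simp only [Finset.sum_insert hi]
    exact HD.add _ _ _ _ (h i (Finset.mem_insert_self _ _))
      (ih fun j hj => h j (Finset.mem_insert_of_mem hj))

lemma HD.hasDerivAt {p : ℂ → CoordRing Q} {p' : CoordRing Q} (h : HD p p')
    (l : CoordRing Q →ₗ[ℂ] ℂ) : HasDerivAt (fun s => l (p s)) (l p') 0 := by
  induction h with
  | smul f f' a h => simpa using h.mul_const (l a)
  | add p q p' q' _ _ hp hq =>
    simp only [map_add]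
    exact hp.add hq

/-- The function `∑ i, tr(ξ_i μ_i)`. -/
def comoment (ξ : (i : Q.Vert) → Matrix (Fin (Q.dim i)) (Fin (Q.dim i)) ℂ) : CoordRing Q :=
  ∑ i, (cst Q (ξ i) * moment Q i).trace

lemma comoment_eq (ξ : (i : Q.Vert) → Matrix (Fin (Q.dim i)) (Fin (Q.dim i)) ℂ) :
    comoment ξ = ∑ e, ((cst Q (ξ (Q.tgt e)) * (fwd Q e * bwd Q e)).trace
      - (cst Q (ξ (Q.src e)) * (bwd Q e * fwd Q e)).trace) := by
  let f : (i : Q.Vert) → Matrix (Fin (Q.dim i)) (Fin (Q.dim i)) (CoordRing Q) →+ CoordRing Q :=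
    fun i => (Matrix.traceAddMonoidHom _ _).comp (AddMonoidHom.mulLeft (cst Q (ξ i)))
  change ∑ i, f i (moment Q i) = ∑ e, (f _ _ - f _ _)
  simp only [moment, Finset.sum_apply, map_sum, Pi.sub_apply, map_sub]
  rw [Finset.sum_comm]
  refine Finset.sum_congr rfl fun e _ => ?_
  rw [Finset.sum_sub_distrib]
  simp only [Pi.apply_single (fun i => f i) (fun i => map_zero _)]
  congr 1 <;> simp


lemma moment_eq_comoment (i : Q.Vert) (a b : Fin (Q.dim i)) :
    moment Q i a b = comoment (Pi.single i (Matrix.single b a 1)) := by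
  rw [comoment, Finset.sum_eq_single i]
  · have : cst Q (Matrix.single b a (1 : ℂ)) = Matrix.single b a 1 := by
      rw [cst, Matrix.map_single, map_one]
    rw [Pi.single_eq_same, this, Matrix.trace_single_mul, one_smul]
  · intro j _ hj
    simp [Pi.single_eq_of_ne hj, cst]
  · simp

lemma map_deriv_mul (D : Derivation ℂ (CoordRing Q) (CoordRing Q)) {k l m : ℕ}
    (A : Matrix (Fin k) (Fin l) (CoordRing Q)) (B : Matrix (Fin l) (Fin m) (CoordRing Q)) :
    (A * B).map D = A.map D * B + A * B.map D := by
  ext1 i j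
  simp only [Matrix.map_apply, Matrix.mul_apply, Matrix.add_apply, map_sum, Derivation.leibniz,
    smul_eq_mul, ← Finset.sum_add_distrib]
  exact Finset.sum_congr rfl fun _ _ => by ring

lemma deriv_trace (D : Derivation ℂ (CoordRing Q) (CoordRing Q)) {k l : ℕ}
    (ξ : Matrix (Fin k) (Fin k) ℂ) (A : Matrix (Fin k) (Fin l) (CoordRing Q))
    (B : Matrix (Fin l) (Fin k) (CoordRing Q)) :
    D ((cst Q ξ * (A * B)).trace) =
      (cst Q ξ * (A.map D * B)).trace + (cst Q ξ * (A * B.map D)).trace := by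
  have hC : (cst Q ξ).map D = 0 := by
    ext1 i j
    simp only [Matrix.map_apply, Matrix.zero_apply]
    rw [← MvPolynomial.algebraMap_eq]; exact D.map_algebraMap _
  have ht : ∀ M : Matrix (Fin k) (Fin k) (CoordRing Q), D M.trace = (M.map D).trace := by
    intro M; simp [Matrix.trace]
  rw [ht, map_deriv_mul, hC, map_deriv_mul, Matrix.zero_mul, zero_add, Matrix.mul_add,
    Matrix.trace_add]

lemma bracket_comoment_inl (ξ : (i : Q.Vert) → Matrix (Fin (Q.dim i)) (Fin (Q.dim i)) ℂ)
    (e : Q.Arr) (a b) : bracket (comoment ξ) (X (Sum.inl ⟨e, a, b⟩)) =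
      (cst Q (ξ (Q.tgt e)) * fwd Q e - fwd Q e * cst Q (ξ (Q.src e))) a b := by
  rw [bracket_X_inl, comoment_eq, map_sum, Finset.sum_eq_single e]
  · have h1 : (fwd Q e).map (pderiv (Sum.inr ⟨e, a, b⟩ : Coord Q ⊕ Coord Q)) = 0 := by
      ext1 c d; simp [fwd, pderiv_X]
    have h2 : (bwd Q e).map (pderiv (Sum.inr ⟨e, a, b⟩ : Coord Q ⊕ Coord Q)) =
        Matrix.single b a 1 := by
      ext1 c d
      simp [bwd, pderiv_X, Pi.single_apply, Matrix.single_apply, and_comm, eq_comm]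
    rw [map_sub, deriv_trace, deriv_trace, h1, h2]
    simp only [Matrix.zero_mul, Matrix.mul_zero, Matrix.trace_zero, zero_add, add_zero]
    rw [← Matrix.mul_assoc, Matrix.trace_mul_single, Matrix.trace_mul_comm, Matrix.mul_assoc,
      Matrix.trace_single_mul]
    simp
  · intro e' _ he
    have h1 : (fwd Q e').map (pderiv (Sum.inr ⟨e, a, b⟩ : Coord Q ⊕ Coord Q)) = 0 := by
      ext1 c d; simp [fwd, pderiv_X]
    have h2 : (bwd Q e').map (pderiv (Sum.inr ⟨e, a, b⟩ : Coord Q ⊕ Coord Q)) = 0 := by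
      ext1 c d
      simp [bwd, pderiv_X, he]
    rw [map_sub, deriv_trace, deriv_trace, h1, h2]
    simp
  · simp

lemma bracket_comoment_inr (ξ : (i : Q.Vert) → Matrix (Fin (Q.dim i)) (Fin (Q.dim i)) ℂ)
    (e : Q.Arr) (a b) : bracket (comoment ξ) (X (Sum.inr ⟨e, a, b⟩)) =
      (cst Q (ξ (Q.src e)) * bwd Q e - bwd Q e * cst Q (ξ (Q.tgt e))) b a := by
  rw [bracket_X_inr, comoment_eq, map_sum, Finset.sum_eq_single e]
  · have h1 : (bwd Q e).map (pderiv (Sum.inl ⟨e, a, b⟩ : Coord Q ⊕ Coord Q)) = 0 := by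
      ext1 c d; simp [bwd, pderiv_X]
    have h2 : (fwd Q e).map (pderiv (Sum.inl ⟨e, a, b⟩ : Coord Q ⊕ Coord Q)) =
        Matrix.single a b 1 := by
      ext1 c d
      simp [fwd, pderiv_X, Pi.single_apply, Matrix.single_apply, eq_comm]
    rw [map_sub, deriv_trace, deriv_trace, h1, h2]
    simp only [Matrix.zero_mul, Matrix.mul_zero, Matrix.trace_zero, zero_add, add_zero]
    rw [← Matrix.mul_assoc (cst Q (ξ (Q.src e))), Matrix.trace_mul_single, Matrix.trace_mul_comm,
      Matrix.mul_assoc, Matrix.trace_single_mul]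
    simp
  · intro e' _ he
    have h1 : (bwd Q e').map (pderiv (Sum.inl ⟨e, a, b⟩ : Coord Q ⊕ Coord Q)) = 0 := by
      ext1 c d; simp [bwd, pderiv_X]
    have h2 : (fwd Q e').map (pderiv (Sum.inl ⟨e, a, b⟩ : Coord Q ⊕ Coord Q)) = 0 := by
      ext1 c d
      simp [fwd, pderiv_X, he]
    rw [map_sub, deriv_trace, deriv_trace, h1, h2]
    simp
  · simp

lemma pull_HD (g : ℂ → Gauge Q) (ξ : (i : Q.Vert) → Matrix (Fin (Q.dim i)) (Fin (Q.dim i)) ℂ)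
    (h0 : g 0 = 1) (h1 : ∀ i a b, HasDerivAt (fun s => (g s i).1 a b) (ξ i a b) 0)
    (h2 : ∀ i a b, HasDerivAt (fun s => (g s i)⁻¹.1 a b) (- ξ i a b) 0) (F : CoordRing Q) :
    HD (fun s => pull (g s) F) (bracket (comoment ξ) F) := by
  have p0 : ∀ F : CoordRing Q, pull (g 0) F = F := by
    intro F
    have : pull (g 0) = AlgHom.id ℂ (CoordRing Q) := by
      refine MvPolynomial.algHom_ext fun c => ?_
      rcases c with ⟨e, a, b⟩ | ⟨e, a, b⟩
      · rw [pull_inl, h0]; simp [Matrix.one_apply, Finset.sum_ite_eq]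
      · rw [pull_inr, h0]; simp [Matrix.one_apply, Finset.sum_ite_eq]
    rw [this]; rfl
  induction F using MvPolynomial.induction_on with
  | C a =>
    have : ∀ s, pull (g s) (C a) = C a := fun s => by
      rw [← MvPolynomial.algebraMap_eq, AlgHom.commutes]
    simp only [this, bracket_C_right]
    exact HD.const _
  | add p q hp hq =>
    simp only [map_add, bracket_add_right]
    exact HD.add _ _ _ _ hp hq
  | mul_X p c hp =>
    have hX : HD (fun s => pull (g s) (X c)) (bracket (comoment ξ) (X c)) := by
      rcases c with ⟨e, a, b⟩ | ⟨e, a, b⟩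
      · have hd : ∀ a' b', HD (fun s => ((g s (Q.tgt e)).1 a a' * (g s (Q.src e))⁻¹.1 b' b) •
            (X (Sum.inl ⟨e, a', b'⟩) : CoordRing Q)) _ := fun a' b' =>
          HD.smul _ _ _ ((h1 (Q.tgt e) a a').mul (h2 (Q.src e) b' b))
        simp only [pull_inl]
        convert HD.sum Finset.univ _ _ fun b' _ => HD.sum Finset.univ _ _ fun a' _ => hd a' b'
        rw [bracket_comoment_inl]
        simp [h0, Matrix.one_apply, add_smul, Finset.sum_add_distrib, ite_smul, Matrix.mul_apply,
          fwd, MvPolynomial.smul_eq_C_mul, sub_eq_add_neg]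
        exact Finset.sum_congr rfl fun _ _ => mul_comm _ _
      · have hd : ∀ a' b', HD (fun s => ((g s (Q.src e)).1 b b' * (g s (Q.tgt e))⁻¹.1 a' a) •
            (X (Sum.inr ⟨e, a', b'⟩) : CoordRing Q)) _ := fun a' b' =>
          HD.smul _ _ _ ((h1 (Q.src e) b b').mul (h2 (Q.tgt e) a' a))
        simp only [pull_inr]
        convert HD.sum Finset.univ _ _ fun a' _ => HD.sum Finset.univ _ _ fun b' _ => hd a' b'
        rw [bracket_comoment_inr]
        simp [h0, Matrix.one_apply, add_smul, Finset.sum_add_distrib, ite_smul, Matrix.mul_apply,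
          bwd, MvPolynomial.smul_eq_C_mul, sub_eq_add_neg]
        exact Finset.sum_congr rfl fun _ _ => mul_comm _ _
    simp only [map_mul, bracket_mul_right]
    convert HD.mul hp hX using 1
    simp only [p0]
    ring


lemma exists_curve (i : Q.Vert) (a b : Fin (Q.dim i)) :
    ∃ g : ℂ → Gauge Q, g 0 = 1 ∧
      (∀ j c d, HasDerivAt (fun s => (g s j).1 c d)
        ((Pi.single i (Matrix.single a b (1:ℂ)) :
          (j : Q.Vert) → Matrix (Fin (Q.dim j)) (Fin (Q.dim j)) ℂ) j c d) 0) ∧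
      (∀ j c d, HasDerivAt (fun s => (g s j)⁻¹.1 c d)
        (-(Pi.single i (Matrix.single a b (1:ℂ)) :
          (j : Q.Vert) → Matrix (Fin (Q.dim j)) (Fin (Q.dim j)) ℂ) j c d) 0) := by
  set ξ : (j : Q.Vert) → Matrix (Fin (Q.dim j)) (Fin (Q.dim j)) ℂ :=
    Pi.single i (Matrix.single a b (1:ℂ)) with hξ
  obtain ⟨φ, ψ, κ, hφ0, hψ0, hφ, hψ, h1, h2, hsq⟩ : ∃ (φ ψ : ℂ → ℂ) (κ : ℂ), φ 0 = 0 ∧ ψ 0 = 0 ∧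
      HasDerivAt φ 1 0 ∧ HasDerivAt ψ (-1) 0 ∧ (∀ s, φ s + ψ s + φ s * ψ s * κ = 0) ∧
      (∀ s, ψ s + φ s + ψ s * φ s * κ = 0) ∧ ∀ j, ξ j * ξ j = κ • ξ j := by
    by_cases hab : a = b
    · refine ⟨fun s => Complex.exp s - 1, fun s => Complex.exp (-s) - 1, 1, by simp, by simp,
        ?_, ?_, ?_, ?_, ?_⟩
      · simpa using (Complex.hasDerivAt_exp 0).sub_const 1
      · simpa using ((hasDerivAt_id (0:ℂ)).neg.cexp).sub_const 1
      · intro s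
        have : Complex.exp s * Complex.exp (-s) = 1 := by rw [← Complex.exp_add]; simp
        linear_combination this
      · intro s
        have : Complex.exp s * Complex.exp (-s) = 1 := by rw [← Complex.exp_add]; simp
        linear_combination this
      · intro j
        by_cases hj : j = i
        · subst hj; subst hab; simp [hξ]
        · simp [hξ, Pi.single_eq_of_ne hj]
    · refine ⟨fun s => s, fun s => -s, 0, by simp, by simp, hasDerivAt_id _, hasDerivAt_neg _,
        by simp, by simp, ?_⟩
      intro j
      by_cases hj : j = i
      · subst hj; simp [hξ, Matrix.single_mul_single_of_ne, Ne.symm hab]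
      · simp [hξ, Pi.single_eq_of_ne hj]
  have hmul : ∀ (p q : ℂ) (j : Q.Vert), p + q + p * q * κ = 0 →
      (1 + p • ξ j) * (1 + q • ξ j) = 1 := by
    intro p q j h
    have : (1 + p • ξ j) * (1 + q • ξ j) = 1 + (p + q + p * q * κ) • ξ j := by
      simp only [add_mul, mul_add, one_mul, mul_one, smul_mul_smul_comm, hsq, smul_smul, add_smul]
      abel
    rw [this, h, zero_smul, add_zero]
  refine ⟨fun s j => ⟨1 + φ s • ξ j, 1 + ψ s • ξ j, hmul _ _ _ (h1 s), hmul _ _ _ (h2 s)⟩,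
    ?_, ?_, ?_⟩
  · funext j
    ext1
    simp [hφ0]
  · intro j c d
    simpa using (hφ.mul_const (ξ j c d)).const_add ((1 : Matrix _ _ ℂ) c d)
  · intro j c d
    change HasDerivAt (fun s => (1 + ψ s • ξ j) c d) _ 0
    simpa using (hψ.mul_const (ξ j c d)).const_add ((1 : Matrix _ _ ℂ) c d)

/-- If `b` and `t` are semi-invariant modulo the ideal `I` of `μ⁻¹(0)` for the same weight, then
`F ↦ t² {F, b / t}` preserves `I`. -/
lemma key_moment (χ : Gauge Q → ℂ) (b t : CoordRing Q)
    (hb : ∀ g, pull g b - χ g • b ∈ momentIdeal Q)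
    (ht : ∀ g, pull g t - χ g • t ∈ momentIdeal Q)
    (F : CoordRing Q) (hF : F ∈ momentIdeal Q) :
    t * bracket F b - b * bracket F t ∈ momentIdeal Q := by
  refine Submodule.span_induction (p := fun F _ => t * bracket F b - b * bracket F t ∈
    momentIdeal Q) ?_ ?_ ?_ ?_ hF
  · rintro _ ⟨i, u, v, rfl⟩
    rw [moment_eq_comoment]
    obtain ⟨g, h0, h1, h2⟩ := exists_curve i v u
    set ξ : (j : Q.Vert) → Matrix (Fin (Q.dim j)) (Fin (Q.dim j)) ℂ :=
      Pi.single i (Matrix.single v u (1:ℂ))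
    rw [← Ideal.Quotient.eq_zero_iff_mem]
    refine (Module.forall_dual_apply_eq_zero_iff ℂ _).1 fun l => ?_
    let L : CoordRing Q →ₗ[ℂ] ℂ := l.comp (Ideal.Quotient.mkₐ ℂ (momentIdeal Q)).toLinearMap
    have hL : ∀ F ∈ momentIdeal Q, L F = 0 := fun F hF => by
      change l (Ideal.Quotient.mk _ F) = 0
      rw [Ideal.Quotient.eq_zero_iff_mem.2 hF, map_zero]
    have hd : HD (fun s => t * pull (g s) b + (-b) * pull (g s) t)
        (t * bracket (comoment ξ) b + (-b) * bracket (comoment ξ) t) := by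
      have e1 := HD.mul (HD.const t) (pull_HD g ξ h0 h1 h2 b)
      have e2 := HD.mul (HD.const (-b)) (pull_HD g ξ h0 h1 h2 t)
      simpa using HD.add _ _ _ _ e1 e2
    have hz : (fun s => L (t * pull (g s) b + (-b) * pull (g s) t)) = fun _ => 0 := by
      funext s
      refine hL _ ?_
      have := (momentIdeal Q).sub_mem ((momentIdeal Q).mul_mem_left t (hb (g s)))
        ((momentIdeal Q).mul_mem_left b (ht (g s)))
      convert this using 1
      simp only [MvPolynomial.smul_eq_C_mul]; ring
    have := hd.hasDerivAt L
    rw [hz] at this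
    have h3 := this.unique (hasDerivAt_const _ _)
    rw [show t * bracket (comoment ξ) b - b * bracket (comoment ξ) t =
      t * bracket (comoment ξ) b + (-b) * bracket (comoment ξ) t by ring]
    exact h3
  · rw [← C_0, bracket_C_left, bracket_C_left]; simp
  · intro p q _ _ hp hq
    rw [bracket_add_left, bracket_add_left]
    convert (momentIdeal Q).add_mem hp hq using 1; ring
  · intro p q hq' hq
    rw [smul_eq_mul, bracket_mul_left, bracket_mul_left]
    convert (momentIdeal Q).add_mem ((momentIdeal Q).mul_mem_left p hq)
      ((momentIdeal Q).mul_mem_right (t * bracket p b - b * bracket p t) hq') using 1; ring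


/-! ### Semi-invariants on the zero fibre and the quotients -/

/-- The pullback of functions on `μ⁻¹(0)` along the action of `g`. -/
def pullQ (g : Gauge Q) : FibreRing Q →ₐ[ℂ] FibreRing Q :=
  Ideal.quotientMapₐ _ (pull g) (pull_momentIdeal g)

/-- Restriction of functions to `μ⁻¹(0)`. -/
abbrev toFibre : CoordRing Q →ₐ[ℂ] FibreRing Q := Ideal.Quotient.mkₐ ℂ (momentIdeal Q)

lemma pullQ_toFibre (g : Gauge Q) (F : CoordRing Q) : pullQ g (toFibre F) = toFibre (pull g F) := rfl

/-- The character `g ↦ ∏ i, det(g i) ^ θ i` of `GL(v)`; every character has this form. -/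
def chi (θ : Q.Vert → ℤ) : Gauge Q →* ℂˣ where
  toFun g := ∏ i, Matrix.GeneralLinearGroup.det (g i) ^ θ i
  map_one' := by simp
  map_mul' g h := by simp [mul_zpow, Finset.prod_mul_distrib]

/-- The semi-invariants `{f ∈ ℂ[μ⁻¹(0)] | f(g⁻¹ V) = χ(g)ⁿ f(V)}`. -/
def semiInv (θ : Q.Vert → ℤ) (n : ℕ) : Submodule ℂ (FibreRing Q) where
  carrier := {f | ∀ g : Gauge Q, pullQ g⁻¹ f = ((chi θ g : ℂˣ) : ℂ) ^ n • f}
  zero_mem' g := by simp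
  add_mem' hf hf' g := by rw [map_add, hf g, hf' g, smul_add]
  smul_mem' c f hf g := by rw [map_smul, hf g, smul_comm]

/-- The ring of invariants `ℂ[μ⁻¹(0)]^{GL(v)}`, the coordinate ring of `M_0(v)`. -/
def invariants (Q : DimQuiver) : Subalgebra ℂ (FibreRing Q) where
  carrier := {f | ∀ g : Gauge Q, pullQ g⁻¹ f = f}
  zero_mem' g := by simp
  one_mem' g := by simp
  add_mem' hf hf' g := by rw [map_add, hf g, hf' g]
  mul_mem' hf hf' g := by rw [map_mul, hf g, hf' g]
  algebraMap_mem' c g := AlgHom.commutes _ _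

/-- Semi-invariance with respect to an arbitrary function on the group. -/
def IsSemi (χ : Gauge Q → ℂ) (f : FibreRing Q) : Prop := ∀ g, pullQ g f = χ g • f

lemma isSemi_of_mem {θ : Q.Vert → ℤ} {n : ℕ} {f : FibreRing Q} (h : f ∈ semiInv θ n) :
    IsSemi (fun g => ((chi θ g⁻¹ : ℂˣ) : ℂ) ^ n) f := fun g => by
  simpa using h g⁻¹

lemma mem_of_isSemi {θ : Q.Vert → ℤ} {n : ℕ} {f : FibreRing Q}
    (h : IsSemi (fun g => ((chi θ g⁻¹ : ℂˣ) : ℂ) ^ n) f) : f ∈ semiInv θ n := fun g => by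
  simpa using h g⁻¹

lemma isSemi_of_invariants {f : FibreRing Q} (h : f ∈ invariants Q) :
    IsSemi (fun _ => 1) f := fun g => by
  simpa using h g⁻¹

lemma key_moment' (χ : Gauge Q → ℂ) (b t : CoordRing Q)
    (hb : IsSemi χ (toFibre b)) (ht : IsSemi χ (toFibre t))
    (F : CoordRing Q) (hF : toFibre F = 0) :
    toFibre (t * bracket F b - b * bracket F t) = 0 := by
  rw [Ideal.Quotient.mkₐ_eq_mk, Ideal.Quotient.eq_zero_iff_mem] at hF ⊢
  refine key_moment χ b t (fun g => ?_) (fun g => ?_) F hF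
  · rw [← Ideal.Quotient.eq_zero_iff_mem, ← Ideal.Quotient.mkₐ_eq_mk ℂ, map_sub, map_smul,
      sub_eq_zero]
    exact hb g
  · rw [← Ideal.Quotient.eq_zero_iff_mem, ← Ideal.Quotient.mkₐ_eq_mk ℂ, map_sub, map_smul,
      sub_eq_zero]
    exact ht g

/-- `(s t)² {a / s, b / t}`. -/
def fracNum (a s b t : CoordRing Q) : CoordRing Q :=
  s * t * bracket a b - s * b * bracket a t - a * t * bracket s b + a * b * bracket s t

lemma fracNum_skew (a s b t : CoordRing Q) : fracNum a s b t = - fracNum b t a s := by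
  simp only [fracNum]
  rw [bracket_skew a b, bracket_skew a t, bracket_skew s b, bracket_skew s t]; ring

lemma fracNum_congr_left {χ : Gauge Q → ℂ} {a s a' s' b t : CoordRing Q}
    (hb : IsSemi χ (toFibre b)) (ht : IsSemi χ (toFibre t))
    (ha : toFibre a = toFibre a') (hs : toFibre s = toFibre s') :
    toFibre (fracNum a s b t) = toFibre (fracNum a' s' b t) := by
  have h1 := key_moment' χ b t hb ht (a - a') (by rw [map_sub, ha, sub_self])
  have h2 := key_moment' χ b t hb ht (s - s') (by rw [map_sub, hs, sub_self])
  have e : fracNum a s b t - fracNum a' s' b t =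
      s * (t * bracket (a - a') b - b * bracket (a - a') t)
      - a * (t * bracket (s - s') b - b * bracket (s - s') t)
      + (s - s') * (t * bracket a' b - b * bracket a' t)
      - (a - a') * (t * bracket s' b - b * bracket s' t) := by
    simp only [fracNum, sub_eq_add_neg a, sub_eq_add_neg s, bracket_add_left,
      ← neg_one_smul ℂ a', ← neg_one_smul ℂ s', bracket_smul_left]
    simp only [neg_one_smul]
    ring
  rw [← sub_eq_zero, ← map_sub, e, map_sub, map_add, map_sub, map_mul, map_mul, h1, h2,
    map_mul, map_mul, map_sub toFibre s, map_sub toFibre a, ha, hs]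
  simp

lemma fracNum_congr {χ χ' : Gauge Q → ℂ} {a s a' s' b t b' t' : CoordRing Q}
    (ha' : IsSemi χ (toFibre a)) (hs' : IsSemi χ (toFibre s))
    (hb' : IsSemi χ' (toFibre b)) (ht' : IsSemi χ' (toFibre t))
    (ha : toFibre a = toFibre a') (hs : toFibre s = toFibre s')
    (hb : toFibre b = toFibre b') (ht : toFibre t = toFibre t') :
    toFibre (fracNum a s b t) = toFibre (fracNum a' s' b' t') := by
  rw [fracNum_congr_left hb' ht' ha hs, fracNum_skew, map_neg,
    fracNum_congr_left (ha ▸ ha') (hs ▸ hs') hb ht, ← map_neg, ← fracNum_skew]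

lemma fracNum_isSemi {χ χ' : Gauge Q → ℂ} {a s b t : CoordRing Q}
    (ha : IsSemi χ (toFibre a)) (hs : IsSemi χ (toFibre s))
    (hb : IsSemi χ' (toFibre b)) (ht : IsSemi χ' (toFibre t)) :
    IsSemi (fun g => χ g ^ 2 * χ' g ^ 2) (toFibre (fracNum a s b t)) := by
  intro g
  have aux : ∀ {χ : Gauge Q → ℂ} {a : CoordRing Q}, IsSemi χ (toFibre a) →
      IsSemi χ (toFibre (pull g a)) := by
    intro χ a ha h
    rw [← pullQ_toFibre, ha g, map_smul, ha h, smul_comm]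
  have aux2 : ∀ {χ : Gauge Q → ℂ} {a : CoordRing Q}, IsSemi χ (toFibre a) →
      toFibre (pull g a) = toFibre (χ g • a) := by
    intro χ a ha
    rw [← pullQ_toFibre, ha g, map_smul]
  rw [pullQ_toFibre]
  have e : pull g (fracNum a s b t) = fracNum (pull g a) (pull g s) (pull g b) (pull g t) := by
    simp only [fracNum, map_add, map_sub, map_mul, pull_bracket]
  rw [e, fracNum_congr (aux ha) (aux hs) (aux hb) (aux ht) (aux2 ha) (aux2 hs) (aux2 hb) (aux2 ht),
    ← map_smul]
  congr 1
  simp only [fracNum, bracket_smul_left, bracket_smul_right]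
  simp only [MvPolynomial.smul_eq_C_mul, map_mul, map_pow]
  ring

/-- Some function on `Rep(Q̄, v)` that restricts to `f` on `μ⁻¹(0)`. -/
def lift (f : FibreRing Q) : CoordRing Q := (Ideal.Quotient.mkₐ_surjective ℂ (momentIdeal Q) f).choose

lemma toFibre_lift (f : FibreRing Q) : toFibre (lift f) = f :=
  (Ideal.Quotient.mkₐ_surjective ℂ (momentIdeal Q) f).choose_spec

/-- The Poisson bracket on the coordinate ring `ℂ[μ⁻¹(0)]^{GL(v)}` of `M_0(v)` induced by the
canonical one: extend two invariant functions on `μ⁻¹(0)` to `Rep(Q̄, v)`, take the bracket and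
restrict. The extensions do not matter, by `invBracket_eq`. -/
def invBracket (f g : invariants Q) : invariants Q :=
  ⟨toFibre (bracket (lift f.1) (lift g.1)), fun h => by
    have e : ∀ F G : CoordRing Q, bracket F G = fracNum F 1 G 1 := fun F G => by
      rw [fracNum, ← C_1, bracket_C_left, bracket_C_left, bracket_C_right]; simp
    have h1 : IsSemi (fun _ => 1) (toFibre (1 : CoordRing Q)) := fun g => by simp
    rw [e]
    simpa using fracNum_isSemi (χ := fun _ => 1) (χ' := fun _ => 1)
      (by rw [toFibre_lift]; exact isSemi_of_invariants f.2) h1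
      (by rw [toFibre_lift]; exact isSemi_of_invariants g.2) h1 h⁻¹⟩

lemma invBracket_eq (f g : invariants Q) (F G : CoordRing Q) (hF : toFibre F = f.1)
    (hG : toFibre G = g.1) : (invBracket f g).1 = toFibre (bracket F G) := by
  have e : ∀ F G : CoordRing Q, bracket F G = fracNum F 1 G 1 := fun F G => by
    rw [fracNum, ← C_1, bracket_C_left, bracket_C_left, bracket_C_right]; simp
  have h1 : IsSemi (fun _ => 1) (toFibre (1 : CoordRing Q)) := fun g => by simp
  change toFibre (bracket _ _) = _
  rw [e, e]
  exact fracNum_congr (χ := fun _ => 1) (χ' := fun _ => 1)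
    (by rw [toFibre_lift]; exact isSemi_of_invariants f.2) h1
    (by rw [toFibre_lift]; exact isSemi_of_invariants g.2) h1
    (by rw [toFibre_lift, hF]) rfl (by rw [toFibre_lift, hG]) rfl

/-! ### The variety `M_χ(v)` -/

instance (θ : Q.Vert → ℤ) : SetLike.GradedMonoid (semiInv θ) where
  one_mem g := by simp
  mul_mem n m f f' hf hf' g := by
    rw [map_mul, hf g, hf' g, smul_mul_smul_comm, pow_add]

/-- The graded ring `⨁ n, ℂ[μ⁻¹(0)]^{GL(v), χⁿ}`. -/
def SemiInvRing (θ : Q.Vert → ℤ) : Type := DirectSum ℕ fun n => semiInv θ n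

instance (θ : Q.Vert → ℤ) : CommRing (SemiInvRing θ) :=
  inferInstanceAs (CommRing (DirectSum ℕ fun n => semiInv θ n))

instance (θ : Q.Vert → ℤ) : Algebra ℂ (SemiInvRing θ) :=
  inferInstanceAs (Algebra ℂ (DirectSum ℕ fun n => semiInv θ n))

/-- The inclusion of the `n`-th summand. -/
def homog (θ : Q.Vert → ℤ) (n : ℕ) : semiInv θ n →ₗ[ℂ] SemiInvRing θ :=
  DirectSum.lof ℂ ℕ (fun n => semiInv θ n) n

/-- The homogeneous elements of degree `n`. -/
def piece (θ : Q.Vert → ℤ) (n : ℕ) : Submodule ℂ (SemiInvRing θ) :=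
  LinearMap.range (homog θ n)

lemma homog_mul (θ : Q.Vert → ℤ) (n m : ℕ) (a : semiInv θ n) (b : semiInv θ m) :
    homog θ n a * homog θ m b = homog θ (n + m) ⟨a.1 * b.1, SetLike.GradedMul.mul_mem a.2 b.2⟩ :=
  DirectSum.of_mul_of (A := fun n => semiInv θ n) _ _

lemma homog_one (θ : Q.Vert → ℤ) : (1 : SemiInvRing θ) = homog θ 0 ⟨1, SetLike.GradedOne.one_mem⟩ :=
  rfl

lemma SemiInvRing.induction (θ : Q.Vert → ℤ) {p : SemiInvRing θ → Prop} (f : SemiInvRing θ)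
    (h0 : p 0) (h1 : ∀ n a, p (homog θ n a)) (h2 : ∀ a b, p a → p b → p (a + b)) : p f :=
  DirectSum.induction_on f h0 h1 h2

/-- The decomposition into homogeneous components. -/
def toPieces (θ : Q.Vert → ℤ) : SemiInvRing θ →ₗ[ℂ] DirectSum ℕ (fun n => piece θ n) :=
  DirectSum.toModule ℂ ℕ _ fun n =>
    (DirectSum.lof ℂ ℕ (fun n => piece θ n) n).comp (LinearMap.rangeRestrict (homog θ n))

lemma toPieces_homog (θ : Q.Vert → ℤ) (n : ℕ) (a : semiInv θ n) :
    toPieces θ (homog θ n a) =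
      DirectSum.lof ℂ ℕ (fun n => piece θ n) n ⟨homog θ n a, LinearMap.mem_range_self _ _⟩ :=
  DirectSum.toModule_lof (M := fun n => semiInv θ n) ℂ n a

instance (θ : Q.Vert → ℤ) : GradedAlgebra (piece θ) where
  one_mem := ⟨⟨1, SetLike.GradedOne.one_mem⟩, rfl⟩
  mul_mem := by
    rintro n m _ _ ⟨a, rfl⟩ ⟨b, rfl⟩
    exact ⟨_, (homog_mul θ n m a b).symm⟩
  decompose' := toPieces θ
  left_inv := by
    intro f
    induction f using SemiInvRing.induction with
    | h0 => simp
    | h1 n a =>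
      rw [toPieces_homog]
      exact DirectSum.coeAddMonoidHom_of _ _ _
    | h2 a b ha hb => rw [map_add, map_add, ha, hb]
  right_inv := by
    intro f
    induction f using DirectSum.induction_on with
    | zero => simp
    | of n a =>
      obtain ⟨_, a, rfl⟩ := a
      rw [DirectSum.coeAddMonoidHom_of]
      rw [toPieces_homog]
      rfl
    | add a b ha hb => rw [map_add, map_add, ha, hb]

/-- The ring homomorphism that adds up the components; on a homogeneous element it is the
underlying function on `μ⁻¹(0)`. -/
def coeSum (θ : Q.Vert → ℤ) : SemiInvRing θ →+* FibreRing Q :=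
  DirectSum.coeRingHom (semiInv θ)

lemma coeSum_homog (θ : Q.Vert → ℤ) (n : ℕ) (a : semiInv θ n) : coeSum θ (homog θ n a) = a :=
  DirectSum.coeRingHom_of (semiInv θ) n a


lemma coeSum_mem (θ : Q.Vert → ℤ) {n : ℕ} {f : SemiInvRing θ} (h : f ∈ piece θ n) :
    coeSum θ f ∈ semiInv θ n := by
  obtain ⟨a, rfl⟩ := h
  rw [coeSum_homog]; exact a.2

lemma coeSum_inj (θ : Q.Vert → ℤ) {n : ℕ} {f f' : SemiInvRing θ} (h : f ∈ piece θ n)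
    (h' : f' ∈ piece θ n) (e : coeSum θ f = coeSum θ f') : f = f' := by
  obtain ⟨a, rfl⟩ := h
  obtain ⟨a', rfl⟩ := h'
  rw [coeSum_homog, coeSum_homog] at e
  rw [Subtype.ext e]

open HomogeneousLocalization

lemma fracBracket_mem (θ : Q.Vert → ℤ) {n m : ℕ} {a s b t : FibreRing Q} (ha : a ∈ semiInv θ n)
    (hs : s ∈ semiInv θ n) (hb : b ∈ semiInv θ m) (ht : t ∈ semiInv θ m) :
    toFibre (fracNum (lift a) (lift s) (lift b) (lift t)) ∈ semiInv θ (n + m + (n + m)) := by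
  refine mem_of_isSemi ?_
  have h : ∀ {k : ℕ} {c : FibreRing Q}, c ∈ semiInv θ k →
      IsSemi (fun g => ((chi θ g⁻¹ : ℂˣ) : ℂ) ^ k) (toFibre (lift c)) := fun {k c} hc => by
    rw [toFibre_lift]; exact isSemi_of_mem hc
  have := fracNum_isSemi (h ha) (h hs) (h hb) (h ht)
  convert this using 2
  ring

/-- The bracket `{a / s, b / t}` of two fractions of degree zero, computed by the quotient rule on
extensions of `a, s, b, t` to `Rep(Q̄, v)`. The choices do not matter, by `fracNum_congr` and
`fracBracket_wd_left`. -/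
def fracBracket (θ : Q.Vert → ℤ) {S : Submonoid (SemiInvRing θ)}
    (p q : NumDenSameDeg (piece θ) S) : NumDenSameDeg (piece θ) S where
  deg := p.deg + q.deg + (p.deg + q.deg)
  num := ⟨homog θ (p.deg + q.deg + (p.deg + q.deg)) ⟨_, fracBracket_mem θ
    (coeSum_mem θ p.num.2) (coeSum_mem θ p.den.2) (coeSum_mem θ q.num.2) (coeSum_mem θ q.den.2)⟩,
    LinearMap.mem_range_self _ _⟩
  den := ⟨p.den.1 * q.den.1 * (p.den.1 * q.den.1), SetLike.GradedMul.mul_mem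
    (SetLike.GradedMul.mul_mem p.den.2 q.den.2) (SetLike.GradedMul.mul_mem p.den.2 q.den.2)⟩
  den_mem := S.mul_mem (S.mul_mem p.den_mem q.den_mem) (S.mul_mem p.den_mem q.den_mem)

lemma fracNum_wd {χ : Gauge Q → ℂ} {u a s a' s' b t : CoordRing Q}
    (hb : IsSemi χ (toFibre b)) (ht : IsSemi χ (toFibre t))
    (h : toFibre (u * (s' * a)) = toFibre (u * (s * a'))) :
    toFibre (u * u * (s' * s' * fracNum a s b t)) =
      toFibre (u * u * (s * s * fracNum a' s' b t)) := by
  have h0 : toFibre (u * (s' * a) - u * (s * a')) = 0 := by rw [map_sub, h, sub_self]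
  have h1 := key_moment' χ b t hb ht _ h0
  have e : u * u * (s' * s' * fracNum a s b t) - u * u * (s * s * fracNum a' s' b t) =
      (u * s * s') * (t * bracket (u * (s' * a) - u * (s * a')) b
        - b * bracket (u * (s' * a) - u * (s * a')) t)
      - (s * s' * (t * bracket u b - b * bracket u t)
        + u * s' * (t * bracket s b - b * bracket s t)
        + u * s * (t * bracket s' b - b * bracket s' t)) * (u * (s' * a) - u * (s * a')) := by
    simp only [fracNum, sub_eq_add_neg (u * (s' * a)), bracket_add_left,
      ← neg_one_smul ℂ (u * (s * a')), bracket_smul_left, bracket_mul_left]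
    simp only [neg_one_smul]
    ring
  rw [← sub_eq_zero, ← map_sub, e, map_sub, map_mul, h1, map_mul _ _ (_ - _), h0]
  simp

lemma exists_homog (θ : Q.Vert → ℤ) (x : ProjectiveSpectrum (piece θ)) {c z : SemiInvRing θ}
    {n : ℕ} (hz : z ∈ piece θ n) (hc : c ∉ x.asHomogeneousIdeal.toIdeal) (h : c * z = 0) :
    ∃ k, ∃ u ∈ piece θ k, u ∉ x.asHomogeneousIdeal.toIdeal ∧ u * z = 0 := by
  by_contra! H
  refine hc ((Ideal.IsHomogeneous.mem_iff (𝒜 := piece θ) x.asHomogeneousIdeal.2).2 fun k => ?_)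
  by_contra hk
  refine H k _ (SetLike.coe_mem _) hk ?_
  rw [← DirectSum.coe_decompose_mul_add_of_right_mem (piece θ) hz, h]
  simp

lemma fracBracket_wd_left (θ : Q.Vert → ℤ) (x : ProjectiveSpectrum (piece θ))
    (p p' q : NumDenSameDeg (piece θ) x.asHomogeneousIdeal.toIdeal.primeCompl)
    (h : HomogeneousLocalization.mk p = HomogeneousLocalization.mk p') :
    HomogeneousLocalization.mk (fracBracket θ p q) =
      HomogeneousLocalization.mk (fracBracket θ p' q) := by
  rw [HomogeneousLocalization.ext_iff_val, val_mk, val_mk, Localization.mk_eq_mk_iff,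
    Localization.r_iff_exists] at h ⊢
  obtain ⟨⟨c, hc⟩, h⟩ := h
  have hz : p'.den.1 * p.num.1 - p.den.1 * p'.num.1 ∈ piece θ (p.deg + p'.deg) :=
    Submodule.sub_mem _ (by rw [add_comm]; exact SetLike.GradedMul.mul_mem p'.den.2 p.num.2)
      (SetLike.GradedMul.mul_mem p.den.2 p'.num.2)
  obtain ⟨k, u, hu, hux, huz⟩ := exists_homog θ x hz hc (by rw [mul_sub, sub_eq_zero]; exact h)
  rw [mul_sub, sub_eq_zero] at huz
  refine ⟨⟨u * u, mul_mem hux hux⟩, ?_⟩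
  change u * u * (p'.den.1 * q.den.1 * (p'.den.1 * q.den.1) * homog θ _ _) =
    u * u * (p.den.1 * q.den.1 * (p.den.1 * q.den.1) * homog θ _ _)
  refine coeSum_inj θ (n := k + k + (p'.deg + q.deg + (p'.deg + q.deg) +
    (p.deg + q.deg + (p.deg + q.deg)))) ?_ ?_ ?_
  · exact SetLike.GradedMul.mul_mem (SetLike.GradedMul.mul_mem hu hu)
      (SetLike.GradedMul.mul_mem (SetLike.GradedMul.mul_mem
        (SetLike.GradedMul.mul_mem p'.den.2 q.den.2) (SetLike.GradedMul.mul_mem p'.den.2 q.den.2))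
        (LinearMap.mem_range_self _ _))
  · rw [add_comm (p'.deg + q.deg + _)]
    exact SetLike.GradedMul.mul_mem (SetLike.GradedMul.mul_mem hu hu)
      (SetLike.GradedMul.mul_mem (SetLike.GradedMul.mul_mem
        (SetLike.GradedMul.mul_mem p.den.2 q.den.2) (SetLike.GradedMul.mul_mem p.den.2 q.den.2))
        (LinearMap.mem_range_self _ _))
  · have h3 := congrArg (coeSum θ) huz
    simp only [map_mul, coeSum_homog] at h3 ⊢
    have h4 := fracNum_wd (u := lift (coeSum θ u)) (a := lift (coeSum θ p.num.1))
      (s := lift (coeSum θ p.den.1)) (a' := lift (coeSum θ p'.num.1))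
      (s' := lift (coeSum θ p'.den.1)) (b := lift (coeSum θ q.num.1)) (t := lift (coeSum θ q.den.1))
      (χ := fun g => ((chi θ g⁻¹ : ℂˣ) : ℂ) ^ q.deg)
      (by rw [toFibre_lift]; exact isSemi_of_mem (coeSum_mem θ q.num.2))
      (by rw [toFibre_lift]; exact isSemi_of_mem (coeSum_mem θ q.den.2))
      (by simp only [map_mul, toFibre_lift]; exact h3)
    simp only [map_mul toFibre, toFibre_lift] at h4
    linear_combination (coeSum θ q.den.1) ^ 2 * h4

lemma fracBracket_skew (θ : Q.Vert → ℤ) {S : Submonoid (SemiInvRing θ)}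
    (p q : NumDenSameDeg (piece θ) S) :
    HomogeneousLocalization.mk (fracBracket θ p q) =
      - HomogeneousLocalization.mk (fracBracket θ q p) := by
  rw [HomogeneousLocalization.ext_iff_val, val_neg, val_mk, val_mk, Localization.neg_mk,
    Localization.mk_eq_mk_iff, Localization.r_iff_exists]
  refine ⟨1, ?_⟩
  change 1 * (q.den.1 * p.den.1 * (q.den.1 * p.den.1) * homog θ _ _) =
    1 * (p.den.1 * q.den.1 * (p.den.1 * q.den.1) * - homog θ _ _)
  refine coeSum_inj θ (n := (q.deg + p.deg + (q.deg + p.deg) +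
    (p.deg + q.deg + (p.deg + q.deg)))) ?_ ?_ ?_
  · rw [one_mul]
    exact 
      (SetLike.GradedMul.mul_mem (SetLike.GradedMul.mul_mem
        (SetLike.GradedMul.mul_mem q.den.2 p.den.2) (SetLike.GradedMul.mul_mem q.den.2 p.den.2))
        (LinearMap.mem_range_self _ _))
  · rw [add_comm (q.deg + p.deg + _), one_mul]
    exact 
      (SetLike.GradedMul.mul_mem (SetLike.GradedMul.mul_mem
        (SetLike.GradedMul.mul_mem p.den.2 q.den.2) (SetLike.GradedMul.mul_mem p.den.2 q.den.2))
        (Submodule.neg_mem _ (LinearMap.mem_range_self _ _)))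
  · simp only [map_mul, map_neg, coeSum_homog, map_one]
    rw [fracNum_skew, map_neg]
    ring

/-- The Poisson bracket on the stalk of the structure sheaf of `M_χ(v)` at `x`. -/
def stalkBracket (θ : Q.Vert → ℤ) (x : ProjectiveSpectrum (piece θ))
    (f g : HomogeneousLocalization.AtPrime (piece θ) x.asHomogeneousIdeal.toIdeal) :
    HomogeneousLocalization.AtPrime (piece θ) x.asHomogeneousIdeal.toIdeal :=
  Quotient.map₂ (fracBracket θ) (fun p p' hp q q' hq => by
    refine (Quotient.exact (a := fracBracket θ p q) (b := fracBracket θ p' q') ?_)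
    change HomogeneousLocalization.mk _ = HomogeneousLocalization.mk _
    rw [fracBracket_wd_left θ x p p' q (Quotient.sound hp), fracBracket_skew,
      fracBracket_wd_left θ x q q' p' (Quotient.sound hq), ← fracBracket_skew]) f g

lemma stalkBracket_mk (θ : Q.Vert → ℤ) (x : ProjectiveSpectrum (piece θ))
    (p q : NumDenSameDeg (piece θ) x.asHomogeneousIdeal.toIdeal.primeCompl) :
    stalkBracket θ x (HomogeneousLocalization.mk p) (HomogeneousLocalization.mk q) =
      HomogeneousLocalization.mk (fracBracket θ p q) := rfl

open AlgebraicGeometry TopologicalSpace Opposite CategoryTheory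

/-- The quiver variety `M_χ(v) = μ⁻¹(0) //_χ GL(v) = Proj ⨁ n, ℂ[μ⁻¹(0)]^{GL(v), χⁿ}`. -/
abbrev quiverVariety (θ : Q.Vert → ℤ) : Scheme := Proj (piece θ)

/-- The affine quiver variety `M_0(v) = μ⁻¹(0) // GL(v) = Spec ℂ[μ⁻¹(0)]^{GL(v)}`. -/
abbrev affineQuiverVariety (Q : DimQuiver) : Scheme := Spec (CommRingCat.of (invariants Q))

/-- Invariants as elements of degree zero. -/
def toDegreeZero (θ : Q.Vert → ℤ) : invariants Q →+* piece θ 0 where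
  toFun f := ⟨homog θ 0 ⟨f.1, fun g => by simpa using f.2 g⟩, LinearMap.mem_range_self _ _⟩
  map_one' := rfl
  map_zero' := Subtype.ext (map_zero (homog θ 0))
  map_add' f g := Subtype.ext (map_add (homog θ 0) ⟨f.1, _⟩ ⟨g.1, _⟩)
  map_mul' f g := Subtype.ext (homog_mul θ 0 0 ⟨f.1, _⟩ ⟨g.1, _⟩).symm

/-- The natural morphism `π : M_χ(v) ⟶ M_0(v)`. -/
def proj (θ : Q.Vert → ℤ) : quiverVariety θ ⟶ affineQuiverVariety Q :=
  Proj.toSpecZero (piece θ) ≫ Spec.map (CommRingCat.ofHom (toDegreeZero θ))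

lemma sectionBracket_mem (θ : Q.Vert → ℤ) (U : Opens (ProjectiveSpectrum.top (piece θ)))
    (f g : (ProjectiveSpectrum.StructureSheaf.structureSheafInType (piece θ)).1.obj (op U)) :
    (ProjectiveSpectrum.StructureSheaf.isLocallyFraction (piece θ)).pred
      (fun x : U => stalkBracket θ x.1 (f.1 x) (g.1 x)) := fun x => by
  obtain ⟨Va, ma, ia, ja, ra, sa, hwa, wa⟩ := f.2 x
  obtain ⟨Vb, mb, ib, jb, rb, sb, hwb, wb⟩ := g.2 x
  refine ⟨Va ⊓ Vb, ⟨ma, mb⟩, Opens.infLELeft _ _ ≫ ia, ja + jb + (ja + jb),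
    ⟨homog θ (ja + jb + (ja + jb)) ⟨_, fracBracket_mem θ
      (coeSum_mem θ ra.2) (coeSum_mem θ sa.2) (coeSum_mem θ rb.2) (coeSum_mem θ sb.2)⟩,
      LinearMap.mem_range_self _ _⟩,
    ⟨sa.1 * sb.1 * (sa.1 * sb.1), SetLike.GradedMul.mul_mem
      (SetLike.GradedMul.mul_mem sa.2 sb.2) (SetLike.GradedMul.mul_mem sa.2 sb.2)⟩,
    fun y => ?_, fun y => ?_⟩
  · have := y.1.isPrime
    have h : sa.1 * sb.1 ∈ y.1.asHomogeneousIdeal.toIdeal.primeCompl :=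
      Submonoid.mul_mem _ (hwa ⟨y.1, y.2.1⟩) (hwb ⟨y.1, y.2.2⟩)
    exact Submonoid.mul_mem _ h h
  · have e1 := wa ⟨y.1, y.2.1⟩
    have e2 := wb ⟨y.1, y.2.2⟩
    exact (congrArg₂ (stalkBracket θ y.1) e1 e2).trans (stalkBracket_mk θ y.1 _ _)

/-- The Poisson bracket on the sections of the structure sheaf of `M_χ(v)` over an open set `U`
induced by the canonical bracket on `Rep(Q̄, v)`, computed in the stalks. -/
def sectionBracket (θ : Q.Vert → ℤ) (U : (quiverVariety θ).Opens) (f g : Γ(quiverVariety θ, U)) :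
    Γ(quiverVariety θ, U) :=
  let f' : (ProjectiveSpectrum.StructureSheaf.structureSheafInType (piece θ)).1.obj (op U) := f
  let g' : (ProjectiveSpectrum.StructureSheaf.structureSheafInType (piece θ)).1.obj (op U) := g
  let h : (ProjectiveSpectrum.StructureSheaf.structureSheafInType (piece θ)).1.obj (op U) :=
    ⟨fun x => stalkBracket θ x.1 (f'.1 x) (g'.1 x), sectionBracket_mem θ U f' g'⟩
  h


/-! ### Star-shaped quivers and the Hitchin map -/

section Star

open scoped TensorProduct

/-- The star-shaped quiver with a central vertex `none` of dimension `r` and `n` legs; the `m`-th leg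
has `len m` vertices, of dimensions `γ m 0, γ m 1, …`, and all arrows point to the centre: the arrow
`⟨m, i⟩` starts at the vertex `i` of the leg `m` and ends at the vertex `i - 1` of that leg, or at
the centre if `i = 0`. -/
def starQuiver (n r : ℕ) (len : Fin n → ℕ) (γ : (m : Fin n) → Fin (len m) → ℕ) : DimQuiver where
  Vert := Option (Σ m : Fin n, Fin (len m))
  Arr := Σ m : Fin n, Fin (len m)
  src := some
  tgt
    | ⟨_, ⟨0, _⟩⟩ => none
    | ⟨m, ⟨i + 1, h⟩⟩ => some ⟨m, ⟨i, Nat.lt_of_succ_lt h⟩⟩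
  dim
    | none => r
    | some ⟨m, i⟩ => γ m i

variable {n r : ℕ} {len : Fin n → ℕ} {γ : (m : Fin n) → Fin (len m) → ℕ}

variable (r len γ) in
/-- The arrow of the `m`-th leg that ends at the centre. -/
def innerArr (m : Fin n) (h : 0 < len m) : (starQuiver n r len γ).Arr := Sigma.mk m ⟨0, h⟩

variable (r len γ) in
/-- The map `g_1 : ℂ^{γ_1} → ℂ^r` of the `m`-th leg. -/
def gOne (m : Fin n) (h : 0 < len m) :
    Matrix (Fin r) (Fin (γ m ⟨0, h⟩)) (CoordRing (starQuiver n r len γ)) :=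
  fwd (starQuiver n r len γ) (innerArr r len γ m h)

variable (r len γ) in
/-- The map `f_1 : ℂ^r → ℂ^{γ_1}` of the `m`-th leg. -/
def fOne (m : Fin n) (h : 0 < len m) :
    Matrix (Fin (γ m ⟨0, h⟩)) (Fin r) (CoordRing (starQuiver n r len γ)) :=
  bwd (starQuiver n r len γ) (innerArr r len γ m h)

variable (r len γ) in
/-- `φ^m = g_1^m ∘ f_1^m` (zero if the `m`-th leg is empty). -/
def residue (m : Fin n) : Matrix (Fin r) (Fin r) (CoordRing (starQuiver n r len γ)) :=
  if h : 0 < len m then gOne r len γ m h * fOne r len γ m h else 0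

variable (r len γ) in
/-- `φ_V(z) = ∑ m, φ^m / (z - x_m)` at a number `z`. -/
def higgsAt (x : Fin n → ℂ) (z : ℂ) : Matrix (Fin r) (Fin r) (CoordRing (starQuiver n r len γ)) :=
  ∑ m, (z - x m)⁻¹ • residue r len γ m

variable (r len γ) in
/-- `φ_V(z) = ∑ m, φ^m / (z - x_m)` as a matrix with entries in `ℂ[Rep(Q̄, v)] ⊗ ℂ(z)`. -/
def higgs (x : Fin n → ℂ) :
    Matrix (Fin r) (Fin r) (CoordRing (starQuiver n r len γ) ⊗[ℂ] RatFunc ℂ) :=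
  ∑ m, (residue r len γ m).map fun a => a ⊗ₜ (RatFunc.X - RatFunc.C (x m))⁻¹

variable (r len γ) in
/-- `I_t(z) = Tr(φ_V(z)^t)` at a number `z`. -/
def traceAt (x : Fin n → ℂ) (t : ℕ) (z : ℂ) : CoordRing (starQuiver n r len γ) :=
  (higgsAt r len γ x z ^ t).trace

variable (r len γ) in
/-- `I_t(z) = Tr(φ_V(z)^t)` as a rational function of `z`. -/
def traceFun (x : Fin n → ℂ) (t : ℕ) : CoordRing (starQuiver n r len γ) ⊗[ℂ] RatFunc ℂ :=
  (higgs r len γ x ^ t).trace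

/-- The canonical bracket as a bilinear map. -/
def bracketHom (Q : DimQuiver) : CoordRing Q →ₗ[ℂ] CoordRing Q →ₗ[ℂ] CoordRing Q :=
  LinearMap.mk₂ ℂ bracket bracket_add_left bracket_smul_left bracket_add_right bracket_smul_right

/-- The trivial extension of the canonical bracket to rational functions of independent variables
`z` and `w`: `{a p(z), b q(w)} = {a, b} p(z) q(w)`. -/
def extBracket {Q : DimQuiver} (F G : CoordRing Q ⊗[ℂ] RatFunc ℂ) :
    CoordRing Q ⊗[ℂ] (RatFunc ℂ ⊗[ℂ] RatFunc ℂ) :=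
  TensorProduct.map₂ (bracketHom Q) (TensorProduct.mk ℂ (RatFunc ℂ) (RatFunc ℂ)) F G

/-- The coordinate of an element of `A ⊗ W` along a linear functional on `W`. -/
def coordAlong {A W : Type} [CommRing A] [Algebra ℂ A] [AddCommGroup W] [Module ℂ W]
    (ℓ : W →ₗ[ℂ] ℂ) : A ⊗[ℂ] W →ₗ[ℂ] A :=
  (TensorProduct.rid ℂ A).toLinearMap ∘ₗ ℓ.lTensor A

variable (r len γ) in
/-- The coefficient `α_{j+1} = (-1)^{j+1} Tr(∧^{j+1} φ_V(z))` of the characteristic polynomial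
`λ^r + α_1 λ^{r-1} + ⋯ + α_r` of `φ_V(z)`. -/
def charCoeff (x : Fin n → ℂ) (j : Fin r) : CoordRing (starQuiver n r len γ) ⊗[ℂ] RatFunc ℂ :=
  (higgs r len γ x).charpoly.coeff (r - (j + 1))

variable (r len γ) in
/-- The component along the linear functional `ℓ` of the map `V ↦ (α_1, …, α_r)`, as a function on
`Rep(Q̄, v)`. The Hitchin base `∏ j, H⁰(ℙ¹, ω(D)^j)` is, via the trivialization `(dz)^j`, a
subspace of `ℂ(z)^r`, and so is every subspace of it, so that each of its linear coordinates is the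
restriction of some `ℓ`. See `eval_hitchinComp` for the values of this function. -/
def hitchinComp (x : Fin n → ℂ) (ℓ : (Fin r → RatFunc ℂ) →ₗ[ℂ] ℂ) :
    CoordRing (starQuiver n r len γ) :=
  ∑ j, coordAlong (ℓ ∘ₗ LinearMap.single ℂ (fun _ : Fin r => RatFunc ℂ) j) (charCoeff r len γ x j)

variable (r len γ) in
/-- The value `(α_1, …, α_r)` at the representation `V`, given by its matrix entries. -/
def hitchinMap (x : Fin n → ℂ) (V : Coord (starQuiver n r len γ) ⊕ Coord (starQuiver n r len γ) → ℂ)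
    (j : Fin r) : RatFunc ℂ :=
  (∑ m, (residue r len γ m).map fun a => RatFunc.C (aeval V a) * (RatFunc.X - RatFunc.C (x m))⁻¹ :
    Matrix (Fin r) (Fin r) (RatFunc ℂ)).charpoly.coeff (r - (j + 1))

lemma coordAlong_tmul {A W : Type} [CommRing A] [Algebra ℂ A] [AddCommGroup W] [Module ℂ W]
    (ℓ : W →ₗ[ℂ] ℂ) (a : A) (w : W) : coordAlong ℓ (a ⊗ₜ[ℂ] w) = ℓ w • a := by
  simp [coordAlong]

lemma map_coordAlong {A B W : Type} [CommRing A] [Algebra ℂ A] [CommRing B] [Algebra ℂ B]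
    [CommRing W] [Algebra ℂ W]
    (f : A →ₐ[ℂ] B) (ℓ : W →ₗ[ℂ] ℂ) (a : A ⊗[ℂ] W) :
    f (coordAlong ℓ a) = coordAlong ℓ (Algebra.TensorProduct.map f (AlgHom.id ℂ W) a) := by
  induction a with
  | zero => simp
  | tmul a w => simp [coordAlong_tmul]
  | add a b ha hb => simp only [map_add, ha, hb]

theorem eval_hitchinComp (x : Fin n → ℂ) (ℓ : (Fin r → RatFunc ℂ) →ₗ[ℂ] ℂ)
    (V : Coord (starQuiver n r len γ) ⊕ Coord (starQuiver n r len γ) → ℂ) :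
    aeval V (hitchinComp r len γ x ℓ) = ℓ (hitchinMap r len γ x V) := by
  have h1 : ∀ j, hitchinMap r len γ x V j =
      (Algebra.TensorProduct.lid ℂ (RatFunc ℂ)) (Algebra.TensorProduct.map (aeval V)
        (AlgHom.id ℂ (RatFunc ℂ)) (charCoeff r len γ x j)) := by
    intro j
    let f : CoordRing (starQuiver n r len γ) ⊗[ℂ] RatFunc ℂ →+* RatFunc ℂ :=
      ((Algebra.TensorProduct.lid ℂ (RatFunc ℂ)).toAlgHom.comp
        (Algebra.TensorProduct.map (aeval V) (AlgHom.id ℂ (RatFunc ℂ)))).toRingHom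
    change _ = f ((higgs r len γ x).charpoly.coeff (r - (j + 1)))
    rw [← Polynomial.coeff_map, ← Matrix.charpoly_map, hitchinMap]
    congr 2
    ext a b
    simp only [Matrix.sum_apply, Matrix.map_apply, higgs, map_sum]
    refine Finset.sum_congr rfl fun m _ => ?_
    simp [f, Algebra.smul_def]
  have h2 : ∀ (ℓ : RatFunc ℂ →ₗ[ℂ] ℂ) (y : ℂ ⊗[ℂ] RatFunc ℂ),
      coordAlong ℓ y = ℓ (Algebra.TensorProduct.lid ℂ (RatFunc ℂ) y) := by
    intro ℓ y
    induction y with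
    | zero => simp
    | tmul a w => simp [coordAlong_tmul, mul_comm]
    | add a b ha hb => simp only [map_add, ha, hb]
  rw [hitchinComp, map_sum]
  simp only [map_coordAlong, h2, LinearMap.comp_apply, ← h1]
  rw [← map_sum]
  congr 1
  exact Finset.univ_sum_single _

/-- The component of `g` at the central vertex. -/
def central (g : Gauge (starQuiver n r len γ)) : GL (Fin r) ℂ := g none

lemma pull_residue (g : Gauge (starQuiver n r len γ)) (m : Fin n) :
    (residue r len γ m).map (pull g) =
      cst (starQuiver n r len γ) (central g).1 * residue r len γ m *
        cst (starQuiver n r len γ) (central g)⁻¹.1 := by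
  by_cases h : 0 < len m
  · let k : GL (Fin (γ m ⟨0, h⟩)) ℂ := g (some ⟨m, ⟨0, h⟩⟩)
    have e1 : (gOne r len γ m h).map (pull g) = cst (starQuiver n r len γ) (central g).1 * gOne r len γ m h *
      cst (starQuiver n r len γ) k⁻¹.1 := pull_fwd g (innerArr r len γ m h)
    have e2 : (fOne r len γ m h).map (pull g) = cst (starQuiver n r len γ) k.1 * fOne r len γ m h *
      cst (starQuiver n r len γ) (central g)⁻¹.1 := pull_bwd g (innerArr r len γ m h)
    have e3 : (gOne r len γ m h * fOne r len γ m h).map (pull g) =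
        (gOne r len γ m h).map (pull g) * (fOne r len γ m h).map (pull g) :=
      Matrix.map_mul (f := (pull g).toRingHom)
    simp only [residue, dif_pos h]
    rw [e3, e1, e2]
    simp only [Matrix.mul_assoc]
    rw [← Matrix.mul_assoc (cst _ _) (cst _ _), cst_inv_mul, Matrix.one_mul]
  · have h1 : residue r len γ m = 0 := by rw [residue, dif_neg h]
    rw [h1]
    ext1 a b
    simp

lemma pull_hitchinComp (x : Fin n → ℂ) (ℓ : (Fin r → RatFunc ℂ) →ₗ[ℂ] ℂ)
    (g : Gauge (starQuiver n r len γ)) :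
    pull g (hitchinComp r len γ x ℓ) = hitchinComp r len γ x ℓ := by
  have h : ∀ j, Algebra.TensorProduct.map (pull g) (AlgHom.id ℂ (RatFunc ℂ))
      (charCoeff r len γ x j) = charCoeff r len γ x j := by
    intro j
    let f : CoordRing (starQuiver n r len γ) ⊗[ℂ] RatFunc ℂ →+*
        CoordRing (starQuiver n r len γ) ⊗[ℂ] RatFunc ℂ :=
      (Algebra.TensorProduct.map (pull g) (AlgHom.id ℂ (RatFunc ℂ))).toRingHom
    change f ((higgs r len γ x).charpoly.coeff (r - (j + 1))) = _
    rw [← Polynomial.coeff_map, ← Matrix.charpoly_map, charCoeff]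
    let i : ℂ →+* CoordRing (starQuiver n r len γ) ⊗[ℂ] RatFunc ℂ := algebraMap _ _
    let u : (Matrix (Fin r) (Fin r) (CoordRing (starQuiver n r len γ) ⊗[ℂ] RatFunc ℂ))ˣ :=
      Units.map (RingHom.mapMatrix i).toMonoidHom (central g)
    have hu : f.mapMatrix (higgs r len γ x) = u.1 * higgs r len γ x * u⁻¹.1 := by
      let k : RatFunc ℂ → (CoordRing (starQuiver n r len γ) →+
        CoordRing (starQuiver n r len γ) ⊗[ℂ] RatFunc ℂ) := fun q =>
        ((TensorProduct.mk ℂ (CoordRing (starQuiver n r len γ)) (RatFunc ℂ)).flip q).toAddMonoidHom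
      rw [higgs, map_sum, Finset.mul_sum, Finset.sum_mul]
      refine Finset.sum_congr rfl fun m _ => ?_
      have e : f.mapMatrix ((residue r len γ m).map fun a =>
          a ⊗ₜ[ℂ] (RatFunc.X - RatFunc.C (x m))⁻¹) =
          ((residue r len γ m).map (pull g)).map fun a =>
            a ⊗ₜ[ℂ] (RatFunc.X - RatFunc.C (x m))⁻¹ := by
        ext1 a b; simp [f]
      rw [e, pull_residue]
      ext1 a b
      simp only [Matrix.map_apply, Matrix.mul_apply, TensorProduct.sum_tmul, Finset.sum_mul]
      refine Finset.sum_congr rfl fun c _ => Finset.sum_congr rfl fun d _ => ?_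
      have e1 : ∀ z : ℂ, i z = C z ⊗ₜ 1 := fun z => rfl
      change _ = i _ * _ * i _
      rw [e1, e1, Algebra.TensorProduct.tmul_mul_tmul, Algebra.TensorProduct.tmul_mul_tmul]
      simp
    change (f.mapMatrix (higgs r len γ x)).charpoly.coeff _ = _
    rw [hu, Matrix.coe_units_inv, Matrix.charpoly_units_conj]
  rw [hitchinComp, map_sum]
  simp only [map_coordAlong, h]

variable (r len γ) in
/-- The component along `ℓ` of `h⁰_Q` on `M_0(v)`, the descent of the map on `μ⁻¹(0)`. -/
def hitchinInv (x : Fin n → ℂ) (ℓ : (Fin r → RatFunc ℂ) →ₗ[ℂ] ℂ) :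
    invariants (starQuiver n r len γ) :=
  ⟨toFibre (hitchinComp r len γ x ℓ), fun g => by rw [pullQ_toFibre, pull_hitchinComp]⟩

variable (r len γ) in
/-- The component along `ℓ` of `h_Q = h⁰_Q ∘ π` on `M_χ(v)`. -/
def hitchinSection (x : Fin n → ℂ) (θ : (starQuiver n r len γ).Vert → ℤ)
    (ℓ : (Fin r → RatFunc ℂ) →ₗ[ℂ] ℂ) : Γ(quiverVariety θ, ⊤) :=
  (proj θ).appTop ((Scheme.ΓSpecIso (CommRingCat.of (invariants (starQuiver n r len γ)))).inv
    (hitchinInv r len γ x ℓ))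

end Star

end QuiverVariety

end

/-!
The residues `φ^m = g^m_1 f^m_1` at different points Poisson commute, and the entries of each of them
satisfy the commutation relations of `gl(r)` (`bracket_residue`). By partial fractions the matrix
`φ(z) = ∑ φ^m / (z - x_m)` therefore satisfies the classical `r`-matrix relation of the Gaudin model
(`mul_extBracket_higgs`),
`(w - z) {φ(z)_ab, φ(w)_cd} = δ_bc (φ(z) - φ(w))_ad - δ_ad (φ(z) - φ(w))_cb`.

A trace of a power, or a coefficient of the characteristic polynomial, of a matrix `M` has a
gradient `P` for the trace pairing, `df = Tr (P dM)`, and `P` commutes with `M`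
(`hasCommGrad_trace_pow`, `hasCommGrad_charpoly_coeff`; the second is Jacobi's formula, applied to
`λ - M`). If `f` and `g` are such functions of `φ(z)` and `φ(w)`, with gradients `P` and `R`, then
the relation gives `(w - z) {f, g} = Tr (R P D) - Tr (P R D)` with `D = φ(z) - φ(w)`, and this is zero
because `P` commutes with `φ(z)` and `R` with `φ(w)` (`mul_biderivation_eq_zero`). The factor
`w - z` can be cancelled in `A ⊗ (ℂ(z) ⊗ ℂ(w))`, since it is not a zero divisor
(`eq_zero_of_one_tmul_X_sub_X_mul_eq_zero`). For numbers `z = w` the relation, without the factor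
`w - z`, has `D = ∑ φ^m / (z - x_m)²`, and the two traces agree because the gradients are powers of
the same matrix (`bracket_traceAt`).

The components of the Hitchin map are linear coordinates of the coefficients of the characteristic
polynomial, and their brackets are linear coordinates of the brackets with independent variables
(`bracket_coordAlong`), hence zero. On `M_0(v)` the bracket does not depend on the choice of lifts, and
on `M_χ(v)` the germs of the components are the fractions `f / 1` with `f` invariant (`val_proj`), whose
bracket is that of the invariants (`sectionBracket_proj`).
-/

noncomputable section

namespace QuiverVariety

/-! ### Gradients of conjugation invariant functions of a matrix -/

section Gradient

open Matrix

variable {R B : Type*} [CommRing R] [CommRing B]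

/-- The additive map `D : R → B` is a derivation along the ring homomorphism `i : R → B`. -/
def IsDerivAlong (i : R →+* B) (D : R →+ B) : Prop :=
  ∀ a b, D (a * b) = i a * D b + i b * D a

variable {i : R →+* B} {D : R →+ B}

lemma IsDerivAlong.map_one (hD : IsDerivAlong i D) : D 1 = 0 := by
  have := hD 1 1
  simp only [mul_one, _root_.map_one, one_mul] at this
  exact left_eq_add.1 this

lemma IsDerivAlong.map_prod {ι : Type*} [DecidableEq ι] (hD : IsDerivAlong i D) (s : Finset ι)
    (f : ι → R) : D (∏ k ∈ s, f k) = ∑ k ∈ s, (∏ l ∈ s.erase k, i (f l)) * D (f k) := by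
  induction s using Finset.induction_on with
  | empty => simp [hD.map_one]
  | insert k s hk ih =>
    rw [Finset.prod_insert hk, hD, ih, Finset.sum_insert hk, Finset.erase_insert hk,
      _root_.map_prod, add_comm, Finset.mul_sum]
    congr 1
    refine Finset.sum_congr rfl fun l hl => ?_
    have hkl : k ≠ l := fun h => hk (h ▸ hl)
    rw [Finset.erase_insert_of_ne hkl, Finset.prod_insert (fun h => hk (Finset.mem_of_mem_erase h)),
      mul_assoc]

lemma IsDerivAlong.map_mul {k l m : Type*} [Fintype l] (hD : IsDerivAlong i D)
    (M : Matrix k l R) (N : Matrix l m R) :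
    (M * N).map D = M.map D * N.map i + M.map i * N.map D := by
  ext a b
  simp only [Matrix.map_apply, Matrix.mul_apply, Matrix.add_apply, map_sum,
    ← Finset.sum_add_distrib]
  refine Finset.sum_congr rfl fun c _ => ?_
  rw [hD]; ring

variable {n : Type*} [Fintype n] [DecidableEq n]

/-- Jacobi's formula for the derivative of a determinant. -/
lemma IsDerivAlong.map_det (hD : IsDerivAlong i D) (M : Matrix n n R) :
    D M.det = (M.adjugate.map i * M.map D).trace := by
  have h : M.adjugate.map i = (M.map i).adjugate := RingHom.map_adjugate i M
  -- the right-hand side is the sum over the columns of `M` of the determinants in which that column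
  -- is differentiated
  have h2 : ((M.map i).adjugate * M.map D).trace =
      ∑ k, ((M.map i).updateCol k fun l => D (M l k)).det := by
    refine Finset.sum_congr rfl fun k _ => ?_
    rw [← Matrix.cramer_apply, Matrix.cramer_eq_adjugate_mulVec]
    rfl
  rw [h, h2]
  simp only [Matrix.det_apply, map_sum]
  rw [Finset.sum_comm]
  refine Finset.sum_congr rfl fun σ _ => ?_
  rw [← Finset.smul_sum, Units.smul_def, Units.smul_def, map_zsmul, hD.map_prod]
  congr 1
  refine Finset.sum_congr rfl fun k _ => ?_
  rw [← Finset.mul_prod_erase _ _ (Finset.mem_univ k), mul_comm]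
  congr 1
  · simp
  · refine Finset.prod_congr rfl fun l hl => ?_
    simp [Matrix.updateCol_ne (Finset.ne_of_mem_erase hl)]

/-- `P` is the gradient of the function `f` of the matrix `M` with respect to the trace pairing,
`df = Tr (P dM)` for all derivations along `i`, and commutes with `M`, as the gradient of a
conjugation invariant polynomial function over `ℂ` does. -/
structure HasCommGrad (i : R →+* B) (M : Matrix n n R) (f : R) (P : Matrix n n R) : Prop where
  comm : Commute P M
  deriv : ∀ D, IsDerivAlong i D → D f = (P.map i * M.map D).trace

lemma hasCommGrad_trace_pow (i : R →+* B) (M : Matrix n n R) (t : ℕ) :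
    HasCommGrad i M (M ^ t).trace (t • M ^ (t - 1)) := by
  refine ⟨((Commute.refl M).pow_left _).smul_left t, fun D hD => ?_⟩
  -- the general power `M ^ k` on the left absorbs the factors produced by the product rule
  have key : ∀ t k, ((M ^ k).map i * (M ^ t).map D).trace =
      t • ((M ^ (k + t - 1)).map i * M.map D).trace := by
    intro t
    induction t with
    | zero =>
      intro k
      have : (1 : Matrix n n R).map D = 0 := by
        ext a b
        by_cases h : a = b <;> simp [h, hD.map_one]
      simp [this]
    | succ t ih =>
      intro k
      have e1 : (M ^ k).map i * ((M ^ t).map D * M.map i) =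
          (M ^ k).map i * (M ^ t).map D * M.map i := (Matrix.mul_assoc _ _ _).symm
      have e2 : ((M ^ k).map i * (M ^ t).map D * M.map i).trace =
          ((M ^ (k + 1)).map i * (M ^ t).map D).trace := by
        rw [Matrix.trace_mul_comm, ← Matrix.mul_assoc, ← Matrix.map_mul, ← pow_succ']
      have e3 : (M ^ k).map i * ((M ^ t).map i * M.map D) = (M ^ (k + t)).map i * M.map D := by
        rw [← Matrix.mul_assoc, ← Matrix.map_mul, ← pow_add]
      rw [pow_succ, hD.map_mul, Matrix.mul_add, Matrix.trace_add, e1, e2, e3, ih, succ_nsmul,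
        show k + 1 + t - 1 = k + t by omega, show k + (t + 1) - 1 = k + t by omega]
  have h0 : D (M ^ t).trace = ((M ^ 0).map i * (M ^ t).map D).trace := by
    rw [pow_zero, Matrix.map_one _ (map_zero i) (_root_.map_one i), Matrix.one_mul]
    simp [Matrix.trace]
  have h1 : (t • M ^ (t - 1)).map i = t • (M ^ (t - 1)).map i := by
    ext a b
    simp only [Matrix.map_apply, Matrix.smul_apply, map_nsmul]
  rw [h0, key, zero_add, h1, Matrix.smul_mul, Matrix.trace_smul]

open Polynomial in
/-- The coefficientwise extension of an additive map to polynomials. -/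
noncomputable def coeffwise (D : R →+ B) : R[X] →+ B[X] where
  toFun p := p.sum fun k a => monomial k (D a)
  map_zero' := by simp
  map_add' p q := Polynomial.sum_add_index p q _ (by simp) (by simp)

open Polynomial in
lemma coeff_coeffwise (D : R →+ B) (p : R[X]) (k : ℕ) :
    (coeffwise D p).coeff k = D (p.coeff k) := by
  change (p.sum fun k a => monomial k (D a)).coeff k = _
  simp only [Polynomial.sum_def, finsetSum_coeff, coeff_monomial, Finset.sum_ite_eq',
    Polynomial.mem_support_iff]
  split_ifs with h
  · rfl
  · rw [Polynomial.notMem_support_iff.1 h, map_zero]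

open Polynomial in
lemma IsDerivAlong.coeffwise (hD : IsDerivAlong i D) :
    IsDerivAlong (mapRingHom i) (coeffwise D) := fun p q => by
  ext k
  simp only [coeff_coeffwise, coeff_add, coeff_mul, map_sum, coe_mapRingHom, coeff_map, hD _ _,
    Finset.sum_add_distrib]
  congr 1
  exact Finset.sum_nbij' Prod.swap Prod.swap (by simp [add_comm]) (by simp [add_comm])
    (by simp) (by simp) (by simp)

open Polynomial in
/-- The gradient of a coefficient of the characteristic polynomial is, up to sign, the
corresponding coefficient of the adjugate of `λ - M`. -/
lemma hasCommGrad_charpoly_coeff (i : R →+* B) (M : Matrix n n R) (k : ℕ) :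
    HasCommGrad i M (M.charpoly.coeff k) (-(M.charmatrix.adjugate.map fun p => p.coeff k)) := by
  constructor
  · refine Commute.neg_left ?_
    -- compare the coefficients of `λ ^ k` in the relation `adj(λ - M) M = M adj(λ - M)`
    have h1 : Commute M.charmatrix.adjugate (M.map C) := by
      have h2 : Commute M.charmatrix.adjugate M.charmatrix := by
        rw [Commute, SemiconjBy, Matrix.adjugate_mul, Matrix.mul_adjugate]
      have h3 : M.map C = Matrix.scalar n (X : R[X]) - M.charmatrix := by
        simp [Matrix.charmatrix]
      rw [h3]
      exact ((Matrix.scalar_commute X (fun _ => Commute.all _ _) _).symm).sub_right h2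
    ext a b
    have h4 := congrArg (fun p => p.coeff k) (congrFun (congrFun h1 a) b)
    simpa [Matrix.mul_apply] using h4
  · intro D hD
    rw [Matrix.charpoly, ← coeff_coeffwise, hD.coeffwise.map_det]
    have h1 : M.charmatrix.map (coeffwise D) = -(M.map D).map C := by
      ext a b l
      by_cases h : a = b
      · subst h
        by_cases hl : l = 1
        · simp [coeff_coeffwise, hl, hD.map_one]
        · by_cases hl' : l = 0 <;> simp [coeff_coeffwise, coeff_C, hl', coeff_X, Ne.symm hl]
      · by_cases hl : l = 0 <;> simp [coeff_coeffwise, h, coeff_C, hl]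
    rw [h1]
    simp only [Matrix.trace, Matrix.diag, Matrix.mul_apply, finsetSum_coeff]
    refine Finset.sum_congr rfl fun a _ => Finset.sum_congr rfl fun b _ => ?_
    simp

end Gradient

/-! ### Brackets of invariants under a linear `r`-matrix relation -/

section Biderivation

variable {R S B : Type*} [CommRing R] [CommRing S] [CommRing B] {n : Type*} [Fintype n]
  [DecidableEq n] {i : R →+* B} {j : S →+* B} {β : R →+ S →+ B}

/-- The bracket of two invariants of matrices `M`, `N` whose entries satisfy
`e {M_ab, N_cd} = δ_bc D_ad - δ_ad D_cb`, in terms of their gradients `P`, `Q`. The factor `e`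
takes the place of a denominator of the relation. -/
lemma mul_biderivation (hR : ∀ s, IsDerivAlong i (β.flip s)) (hS : ∀ r, IsDerivAlong j (β r))
    {M P : Matrix n n R} {N Q : Matrix n n S} {f : R} {g : S}
    (hf : HasCommGrad i M f P) (hg : HasCommGrad j N g Q) (e : B) (D : Matrix n n B)
    (h : ∀ a b c d, e * β (M a b) (N c d) =
      (if b = c then D a d else 0) - (if a = d then D c b else 0)) :
    e * β f g = (Q.map j * P.map i * D).trace - (P.map i * Q.map j * D).trace := by
  have h1 : β f g = ∑ b, ∑ a, i (P b a) * ∑ d, ∑ c, j (Q d c) * β (M a b) (N c d) := by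
    refine (hf.deriv _ (hR g)).trans ?_
    simp only [Matrix.trace, Matrix.diag, Matrix.mul_apply, Matrix.map_apply]
    refine Finset.sum_congr rfl fun b _ => Finset.sum_congr rfl fun a _ => congrArg _ ?_
    refine (hg.deriv _ (hS (M a b))).trans ?_
    simp only [Matrix.trace, Matrix.diag, Matrix.mul_apply, Matrix.map_apply]
  have h2 : e * β f g = ∑ b, ∑ a, ∑ d, ∑ c, i (P b a) * j (Q d c) *
      ((if b = c then D a d else 0) - (if a = d then D c b else 0)) := by
    simp only [h1, Finset.mul_sum, ← h]
    refine Finset.sum_congr rfl fun b _ => Finset.sum_congr rfl fun a _ =>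
      Finset.sum_congr rfl fun d _ => Finset.sum_congr rfl fun c _ => by ring
  rw [h2]
  simp only [mul_sub, Finset.sum_sub_distrib]
  congr 1
  · simp only [mul_ite, mul_zero, Finset.sum_ite_eq, Finset.mem_univ, if_true, Matrix.trace,
      Matrix.diag, Matrix.mul_apply, Matrix.map_apply, Finset.sum_mul]
    rw [Finset.sum_congr rfl fun b _ => Finset.sum_comm, Finset.sum_comm]
    refine Finset.sum_congr rfl fun d _ => ?_
    rw [Finset.sum_comm]
    refine Finset.sum_congr rfl fun a _ => Finset.sum_congr rfl fun b _ => by ring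
  · simp only [mul_ite, mul_zero, Matrix.trace, Matrix.diag, Matrix.mul_apply, Matrix.map_apply,
      Finset.sum_mul]
    refine Finset.sum_congr rfl fun b _ => ?_
    rw [Finset.sum_congr rfl fun a _ => Finset.sum_comm]
    simp only [Finset.sum_ite_eq, Finset.mem_univ, if_true]
    rw [Finset.sum_comm]

/-- If the matrix `D` of `mul_biderivation` is `M - N`, then the bracket vanishes up to the factor
`e`: by cyclicity of the trace, since `P` commutes with `M` and `Q` with `N`. -/
lemma mul_biderivation_eq_zero (hR : ∀ s, IsDerivAlong i (β.flip s))
    (hS : ∀ r, IsDerivAlong j (β r))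
    {M P : Matrix n n R} {N Q : Matrix n n S} {f : R} {g : S}
    (hf : HasCommGrad i M f P) (hg : HasCommGrad j N g Q) (e : B)
    (h : ∀ a b c d, e * β (M a b) (N c d) =
      (if b = c then (M.map i - N.map j) a d else 0)
        - (if a = d then (M.map i - N.map j) c b else 0)) :
    e * β f g = 0 := by
  have hP : P.map i * M.map i = M.map i * P.map i := by
    rw [← Matrix.map_mul, hf.comm.eq, Matrix.map_mul]
  have hQ : Q.map j * N.map j = N.map j * Q.map j := by
    rw [← Matrix.map_mul, hg.comm.eq, Matrix.map_mul]
  rw [mul_biderivation hR hS hf hg e _ h, Matrix.mul_sub, Matrix.mul_sub, Matrix.trace_sub,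
    Matrix.trace_sub, Matrix.mul_assoc, hP, ← Matrix.mul_assoc, Matrix.trace_mul_comm,
    Matrix.mul_assoc (P.map i) _ (N.map j), hQ, Matrix.mul_assoc (Q.map j),
    Matrix.trace_mul_comm (Q.map j), ← Matrix.mul_assoc, ← Matrix.mul_assoc]
  ring

end Biderivation

/-! ### The ring `K(z) ⊗ K(w)` -/

section Regular

open TensorProduct Polynomial

variable (K : Type*) [Field K]

/-- The inclusion `K[z] ⊗ K[w] → K(z) ⊗ K(w)`. -/
def polyToRat : K[X] ⊗[K] K[X] →ₐ[K] RatFunc K ⊗[K] RatFunc K :=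
  Algebra.TensorProduct.map (IsScalarTower.toAlgHom K K[X] (RatFunc K))
    (IsScalarTower.toAlgHom K K[X] (RatFunc K))

lemma polyToRat_injective : Function.Injective (polyToRat K) := by
  have h : Function.Injective (IsScalarTower.toAlgHom K K[X] (RatFunc K)).toLinearMap :=
    RatFunc.algebraMap_injective K
  exact TensorProduct.map_injective_of_flat_flat _ _ h h

variable {K}

/-- Denominators in `K(z) ⊗ K(w)` can be cleared. -/
lemma exists_mul_mem_range_polyToRat (t : RatFunc K ⊗[K] RatFunc K) :
    ∃ b c : K[X], b ≠ 0 ∧ c ≠ 0 ∧ ∃ s, polyToRat K s = polyToRat K (b ⊗ₜ c) * t := by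
  induction t with
  | zero => exact ⟨1, 1, one_ne_zero, one_ne_zero, 0, by simp⟩
  | tmul f g =>
    refine ⟨f.denom, g.denom, f.denom_ne_zero, g.denom_ne_zero, f.num ⊗ₜ g.num, ?_⟩
    have h : ∀ f : RatFunc K, algebraMap K[X] (RatFunc K) f.num =
        algebraMap K[X] (RatFunc K) f.denom * f := fun f => by
      have h0 : algebraMap K[X] (RatFunc K) f.denom ≠ 0 :=
        RatFunc.algebraMap_ne_zero f.denom_ne_zero
      rw [mul_comm, ← div_eq_iff h0, f.num_div_denom]
    simp [polyToRat, h]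
  | add t t' ht ht' =>
    obtain ⟨b, c, hb, hc, s, hs⟩ := ht
    obtain ⟨b', c', hb', hc', s', hs'⟩ := ht'
    refine ⟨b * b', c * c', mul_ne_zero hb hb', mul_ne_zero hc hc',
      b' ⊗ₜ c' * s + b ⊗ₜ c * s', ?_⟩
    simp only [map_add, map_mul, hs, hs', ← Algebra.TensorProduct.tmul_mul_tmul]
    ring

/-- `w - z` is not a zero divisor in `K(z) ⊗ K(w)`: after clearing denominators this happens in
the domain `K[z] ⊗ K[w]`. -/
lemma eq_zero_of_X_sub_X_mul_eq_zero (t : RatFunc K ⊗[K] RatFunc K)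
    (h : ((1 : RatFunc K) ⊗ₜ[K] (RatFunc.X : RatFunc K) - RatFunc.X ⊗ₜ 1) * t = 0) : t = 0 := by
  obtain ⟨b, c, hb, hc, s, hs⟩ := exists_mul_mem_range_polyToRat t
  have hd : polyToRat K ((1 : K[X]) ⊗ₜ[K] (X : K[X]) - X ⊗ₜ 1) =
      (1 : RatFunc K) ⊗ₜ[K] (RatFunc.X : RatFunc K) - RatFunc.X ⊗ₜ 1 := by
    simp [polyToRat]
  have : IsDomain (K[X] ⊗[K] K[X]) := (polyEquivTensor' K K[X]).symm.toMulEquiv.isDomain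
  have hs0 : s = 0 := by
    have h1 : ((1 : K[X]) ⊗ₜ[K] (X : K[X]) - X ⊗ₜ 1) * s = 0 := by
      apply polyToRat_injective K
      rw [map_mul, hd, hs, map_zero, mul_left_comm, h, mul_zero]
    refine (mul_eq_zero.1 h1).resolve_left fun h2 => ?_
    have h3 := congrArg (polyEquivTensor' K K[X]).symm h2
    rw [map_sub, map_zero] at h3
    have h4 : (X : K[X][X]) - C X = 0 := by
      rw [← h3]
      simp [Polynomial.smul_eq_C_mul]
    exact X_sub_C_ne_zero _ h4
  have hu : IsUnit (polyToRat K (b ⊗ₜ c)) := by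
    have hb' := RatFunc.algebraMap_ne_zero hb
    have hc' := RatFunc.algebraMap_ne_zero hc
    refine IsUnit.of_mul_eq_one
      ((algebraMap K[X] (RatFunc K) b)⁻¹ ⊗ₜ (algebraMap K[X] (RatFunc K) c)⁻¹) ?_
    simp [polyToRat, hb', hc', Algebra.TensorProduct.one_def]
  rw [hs0, map_zero] at hs
  exact hu.mul_right_eq_zero.1 hs.symm

/-- `eq_zero_of_X_sub_X_mul_eq_zero` with coefficients in a `K`-algebra. -/
lemma eq_zero_of_one_tmul_X_sub_X_mul_eq_zero {A : Type*} [CommRing A] [Algebra K A]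
    (t : A ⊗[K] (RatFunc K ⊗[K] RatFunc K))
    (h : ((1 : A) ⊗ₜ[K] ((1 : RatFunc K) ⊗ₜ[K] (RatFunc.X : RatFunc K) - RatFunc.X ⊗ₜ 1)) * t
      = 0) :
    t = 0 := by
  set d : RatFunc K ⊗[K] RatFunc K := 1 ⊗ₜ[K] RatFunc.X - RatFunc.X ⊗ₜ 1 with hd
  have hinj : Function.Injective (LinearMap.mulLeft K d) := by
    rw [← LinearMap.ker_eq_bot, LinearMap.ker_eq_bot']
    exact eq_zero_of_X_sub_X_mul_eq_zero
  have := Module.Flat.lTensor_preserves_injective_linearMap (M := A) _ hinj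
  refine this ?_
  have e : (LinearMap.mulLeft K d).lTensor A = LinearMap.mulLeft K ((1 : A) ⊗ₜ[K] d) := by
    ext; simp
  rw [map_zero, e, LinearMap.mulLeft_apply, h]

end Regular

/-! ### Functions on `Proj` pulled back from the degree zero part -/

section Geometry

open AlgebraicGeometry TopologicalSpace Opposite CategoryTheory HomogeneousLocalization

section GradedRing

universe u

variable {σ : Type*} {A : Type u} [CommRing A] [SetLike σ A] [AddSubgroupClass σ A]
  (𝒜 : ℕ → σ) [GradedRing 𝒜]

/-- On global functions the structure morphism `Proj A ⟶ Spec A₀` sends `a` to the fraction `a / 1`. -/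
lemma toSpecZero_appTop :
    (Scheme.ΓSpecIso (.of (𝒜 0))).inv ≫ (Proj.toSpecZero 𝒜).appTop =
      CommRingCat.ofHom (fromZeroRingHom 𝒜 _) ≫ Proj.awayToSection 𝒜 1 ≫
        (Proj 𝒜).presheaf.map (eqToHom (Proj.basicOpen_one 𝒜).symm).op := by
  rw [Proj.toSpecZero]
  simp only [Scheme.Hom.comp_appTop, Category.assoc]
  rw [← Scheme.ΓSpecIso_inv_naturality_assoc]
  congr 1
  have := Proj.basicOpenToSpec_app_top 𝒜 1
  rw [Scheme.Hom.appTop, this]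
  -- the remaining factors are induced by a section of the open immersion of `D₊(1) = Proj A`
  have hι : ((Scheme.topIso (Proj 𝒜)).inv ≫
      (Scheme.isoOfEq _ (Proj.basicOpen_one 𝒜)).inv) ≫ (Proj.basicOpen 𝒜 1).ι = 𝟙 _ := by simp
  have hι' := congrArg Scheme.Hom.appTop hι
  simp only [Scheme.Hom.comp_appTop, Scheme.Hom.id_appTop] at hι'
  have hr : (Proj.basicOpen 𝒜 1).topIso.inv = (Proj 𝒜).presheaf.map
      (eqToHom (Proj.basicOpen_one 𝒜).symm).op ≫ (Proj.basicOpen 𝒜 1).ι.appTop := by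
    simp [Scheme.Hom.appTop]
    rfl
  rw [hr]
  simp only [Category.assoc, Iso.inv_hom_id_assoc]
  rw [hι', Category.comp_id]

end GradedRing

variable {Q : DimQuiver}

/-- The germ at `x` of the pullback of the invariant function `f` to `M_χ(v)` is `f / 1`. -/
lemma val_proj (θ : Q.Vert → ℤ) (f : invariants Q) (x : ProjectiveSpectrum (piece θ)) :
    ((show (ProjectiveSpectrum.StructureSheaf.structureSheafInType (piece θ)).1.obj (op ⊤) from
      ((proj θ).appTop ((Scheme.ΓSpecIso (CommRingCat.of (invariants Q))).inv f))).1 ⟨x, trivial⟩ :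
      HomogeneousLocalization.AtPrime (piece θ) x.asHomogeneousIdeal.toIdeal) =
    HomogeneousLocalization.mk
      ⟨0, toDegreeZero θ f, ⟨1, SetLike.GradedOne.one_mem⟩, Submonoid.one_mem _⟩ := by
  have h : (proj θ).appTop ((Scheme.ΓSpecIso (CommRingCat.of (invariants Q))).inv f) =
      ((Scheme.ΓSpecIso (.of (piece θ 0))).inv ≫ (Proj.toSpecZero (piece θ)).appTop)
        (toDegreeZero θ f) := by
    rw [proj, ← CommRingCat.comp_apply, Scheme.Hom.comp_appTop,
      ← Scheme.ΓSpecIso_inv_naturality_assoc]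
    rfl
  rw [h, toSpecZero_appTop]
  rfl

lemma fracNum_one_one (F G : CoordRing Q) : fracNum F 1 G 1 = bracket F G := by
  rw [fracNum, ← MvPolynomial.C_1, bracket_C_left, bracket_C_left, bracket_C_right]; simp

/-- The bracket of the germs of two commuting invariant functions is zero. Both numerator and
denominator are lifted in `stalkBracket`, so the lift of the denominator `1` is replaced by `1`
with `fracNum_congr`. -/
lemma stalkBracket_invariants (θ : Q.Vert → ℤ) (x : ProjectiveSpectrum (piece θ))
    (f g : invariants Q) (h : invBracket f g = 0) :
    stalkBracket θ x
      (HomogeneousLocalization.mk ⟨0, toDegreeZero θ f, ⟨1, SetLike.GradedOne.one_mem⟩,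
        Submonoid.one_mem _⟩)
      (HomogeneousLocalization.mk ⟨0, toDegreeZero θ g, ⟨1, SetLike.GradedOne.one_mem⟩,
        Submonoid.one_mem _⟩) = 0 := by
  have h1 : IsSemi (fun _ => 1) (toFibre (1 : CoordRing Q)) := fun g => by simp
  have hs : ∀ f : invariants Q, IsSemi (fun _ => 1) (toFibre (lift f.1)) := fun f => by
    rw [toFibre_lift]; exact isSemi_of_invariants f.2
  have hc : ∀ f : invariants Q, coeSum θ (toDegreeZero θ f).1 = f.1 := fun f => coeSum_homog θ 0 _
  have h2 : toFibre (fracNum (lift f.1) 1 (lift g.1) 1) = 0 := by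
    rw [fracNum_one_one]
    exact congrArg Subtype.val h
  have h3 : toFibre (fracNum (lift (coeSum θ (toDegreeZero θ f).1)) (lift (coeSum θ 1))
      (lift (coeSum θ (toDegreeZero θ g).1)) (lift (coeSum θ 1))) = 0 := by
    rw [hc, hc, ← h2]
    have h4 : toFibre (lift (coeSum θ 1)) = toFibre (1 : CoordRing Q) := by
      rw [toFibre_lift, _root_.map_one, _root_.map_one]
    exact fracNum_congr (hs f) (h4 ▸ h1) (hs g) (h4 ▸ h1) rfl h4 rfl h4
  rw [stalkBracket_mk, HomogeneousLocalization.ext_iff_val, val_mk, val_zero]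
  have h5 : (fracBracket θ
      (⟨0, toDegreeZero θ f, ⟨1, SetLike.GradedOne.one_mem⟩, Submonoid.one_mem _⟩ :
        NumDenSameDeg (piece θ) x.asHomogeneousIdeal.toIdeal.primeCompl)
      ⟨0, toDegreeZero θ g, ⟨1, SetLike.GradedOne.one_mem⟩, Submonoid.one_mem _⟩).num.1 = 0 := by
    change homog θ _ ⟨_, _⟩ = 0
    exact (congrArg (homog θ _) (Subtype.ext h3 : Subtype.mk _ _ = (0 : semiInv θ _))).trans
      (map_zero _)
  rw [h5, Localization.mk_zero]

lemma sectionBracket_proj (θ : Q.Vert → ℤ) (f g : invariants Q) (h : invBracket f g = 0) :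
    sectionBracket θ ⊤
      ((proj θ).appTop ((Scheme.ΓSpecIso (CommRingCat.of (invariants Q))).inv f))
      ((proj θ).appTop ((Scheme.ΓSpecIso (CommRingCat.of (invariants Q))).inv g))
      = 0 := by
  refine Subtype.ext (funext fun x => ?_)
  exact (congrArg₂ (stalkBracket θ x.1) (val_proj θ f x.1) (val_proj θ g x.1)).trans
    (stalkBracket_invariants θ x.1 f g h)

end Geometry

/-! ### The canonical bracket of the entries of `g f` -/

open MvPolynomial Matrix TensorProduct

section Quiver

variable {Q : DimQuiver}

lemma bracket_inl_inl (c d : Coord Q) :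
    bracket (X (Sum.inl c) : CoordRing Q) (X (Sum.inl d)) = 0 := by
  rw [bracket_X_inl, pderiv_X]; simp

lemma bracket_inr_inr (c d : Coord Q) :
    bracket (X (Sum.inr c) : CoordRing Q) (X (Sum.inr d)) = 0 := by
  rw [bracket_X_inr, pderiv_X]; simp

lemma bracket_inr_inl_of_ne {c d : Coord Q} (h : c.1 ≠ d.1) :
    bracket (X (Sum.inr c) : CoordRing Q) (X (Sum.inl d)) = 0 := by
  rw [bracket_X_inl, pderiv_X, Pi.single_apply, if_neg]
  rintro h'
  exact h (congrArg Sigma.fst (Sum.inr_injective h'))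

lemma bracket_inl_inr_of_ne {c d : Coord Q} (h : c.1 ≠ d.1) :
    bracket (X (Sum.inl c) : CoordRing Q) (X (Sum.inr d)) = 0 := by
  rw [bracket_skew, bracket_inr_inl_of_ne h.symm, neg_zero]

lemma bracket_inl_inr (e : Q.Arr) (a b c d) :
    bracket (X (Sum.inl ⟨e, a, b⟩) : CoordRing Q) (X (Sum.inr ⟨e, c, d⟩)) =
      if a = c ∧ b = d then -1 else 0 := by
  rw [bracket_skew, bracket_inr_inl]
  by_cases h : a = c ∧ b = d
  · simp [h]
  · rw [if_neg h, if_neg (fun h' => h ⟨h'.1.symm, h'.2.symm⟩), neg_zero]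

/-- The entries of `g f` satisfy the commutation relations of `gl`: the map `(f, g) ↦ g f` is a
moment map for the action at the target of the arrow. -/
lemma bracket_fwd_mul_bwd (e : Q.Arr) (a b c d : Fin (Q.dim (Q.tgt e))) :
    bracket ((fwd Q e * bwd Q e) a b) ((fwd Q e * bwd Q e) c d) =
      (if b = c then (fwd Q e * bwd Q e) a d else 0) -
        (if a = d then (fwd Q e * bwd Q e) c b else 0) := by
  have term : ∀ k l, bracket
      (X (Sum.inl ⟨e, a, k⟩) * X (Sum.inr ⟨e, b, k⟩) : CoordRing Q)
      (X (Sum.inl ⟨e, c, l⟩) * X (Sum.inr ⟨e, d, l⟩)) = if k = l then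
        (if b = c then X (Sum.inl ⟨e, a, k⟩) * X (Sum.inr ⟨e, d, k⟩) else 0) -
          (if a = d then X (Sum.inl ⟨e, c, k⟩) * X (Sum.inr ⟨e, b, k⟩) else 0) else 0 := by
    intro k l
    simp only [bracket_mul_left, bracket_mul_right, bracket_inl_inl, bracket_inr_inr,
      bracket_inl_inr, bracket_inr_inl]
    by_cases hkl : k = l
    · subst hkl
      simp only [and_true, if_true]
      split_ifs <;> ring
    · simp [hkl]
  simp only [Matrix.mul_apply, fwd, bwd, Matrix.of_apply, bracket_sum_left, bracket_sum_right,
    term]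
  rw [Finset.sum_congr rfl fun l _ => Finset.sum_ite_eq' Finset.univ l _]
  simp only [Finset.mem_univ, if_true, Finset.sum_sub_distrib]
  congr 1 <;> split_ifs <;> simp

lemma bracket_fwd_mul_bwd_of_ne {e e' : Q.Arr} (h : e ≠ e') (a b c d) :
    bracket ((fwd Q e * bwd Q e) a b) ((fwd Q e' * bwd Q e') c d) = 0 := by
  have h1 : ∀ a k c l,
      bracket (X (Sum.inl ⟨e, a, k⟩) : CoordRing Q) (X (Sum.inr ⟨e', c, l⟩)) = 0 :=
    fun a k c l => bracket_inl_inr_of_ne h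
  have h2 : ∀ a k c l,
      bracket (X (Sum.inr ⟨e, a, k⟩) : CoordRing Q) (X (Sum.inl ⟨e', c, l⟩)) = 0 :=
    fun a k c l => bracket_inr_inl_of_ne h
  simp [Matrix.mul_apply, fwd, bwd, bracket_sum_left, bracket_sum_right,
    bracket_mul_left, bracket_mul_right, bracket_inl_inl, bracket_inr_inr, h1, h2]

/-! ### Brackets with independent variables -/

/-- The bracket of two coordinates is a coordinate of the bracket with independent variables. -/
lemma bracket_coordAlong (ℓ ℓ' : RatFunc ℂ →ₗ[ℂ] ℂ) (F G : CoordRing Q ⊗[ℂ] RatFunc ℂ) :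
    bracket (coordAlong ℓ F) (coordAlong ℓ' G) =
      coordAlong ((TensorProduct.lid ℂ ℂ).toLinearMap ∘ₗ TensorProduct.map ℓ ℓ')
        (extBracket F G) := by
  change bracketHom Q _ _ = _
  induction F with
  | zero => simp [extBracket]
  | add F F' hF hF' =>
    simp only [extBracket, map_add, LinearMap.add_apply] at hF hF' ⊢
    rw [hF, hF']
  | tmul a p =>
    induction G with
    | zero => simp [extBracket]
    | add G G' hG hG' =>
      simp only [extBracket, map_add] at hG hG' ⊢
      rw [hG, hG']
    | tmul b q =>
      simp [extBracket, coordAlong_tmul, mul_smul, smul_comm (ℓ p)]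

/-- The embedding of functions with values in `ℂ(z)` as functions with values in `ℂ(z) ⊗ ℂ(w)`
that do not depend on `w`. -/
def leftVar (Q : DimQuiver) :
    CoordRing Q ⊗[ℂ] RatFunc ℂ →+* CoordRing Q ⊗[ℂ] (RatFunc ℂ ⊗[ℂ] RatFunc ℂ) :=
  (Algebra.TensorProduct.map (AlgHom.id ℂ _) Algebra.TensorProduct.includeLeft).toRingHom

lemma leftVar_tmul (a : CoordRing Q) (p : RatFunc ℂ) : leftVar Q (a ⊗ₜ p) = a ⊗ₜ (p ⊗ₜ 1) := rfl

/-- The embedding `F(z) ↦ F(w)` of functions with values in `ℂ(z)` as functions with values in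
`ℂ(z) ⊗ ℂ(w)` that do not depend on `z`. -/
def rightVar (Q : DimQuiver) :
    CoordRing Q ⊗[ℂ] RatFunc ℂ →+* CoordRing Q ⊗[ℂ] (RatFunc ℂ ⊗[ℂ] RatFunc ℂ) :=
  (Algebra.TensorProduct.map (AlgHom.id ℂ _) Algebra.TensorProduct.includeRight).toRingHom

lemma rightVar_tmul (a : CoordRing Q) (p : RatFunc ℂ) :
    rightVar Q (a ⊗ₜ p) = a ⊗ₜ (1 ⊗ₜ p) := rfl

/-- `extBracket` as a biadditive map. -/
def extBracketHom (Q : DimQuiver) : CoordRing Q ⊗[ℂ] RatFunc ℂ →+ CoordRing Q ⊗[ℂ] RatFunc ℂ →+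
    CoordRing Q ⊗[ℂ] (RatFunc ℂ ⊗[ℂ] RatFunc ℂ) :=
  AddMonoidHom.mk' (fun F => (TensorProduct.map₂ (bracketHom Q)
    (TensorProduct.mk ℂ (RatFunc ℂ) (RatFunc ℂ)) F).toAddMonoidHom) fun F F' => by
      ext G; simp

lemma extBracketHom_apply (F G : CoordRing Q ⊗[ℂ] RatFunc ℂ) :
    extBracketHom Q F G = extBracket F G := rfl

lemma extBracket_tmul (a b : CoordRing Q) (p q : RatFunc ℂ) :
    extBracket (a ⊗ₜ p) (b ⊗ₜ q) = bracket a b ⊗ₜ (p ⊗ₜ q) := rfl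

lemma extBracketHom_flip_deriv (G : CoordRing Q ⊗[ℂ] RatFunc ℂ) :
    IsDerivAlong (leftVar Q) ((extBracketHom Q).flip G) := by
  intro F F'
  simp only [AddMonoidHom.flip_apply]
  induction F with
  | zero => simp
  | add F₁ F₂ h₁ h₂ => simp only [add_mul, map_add, AddMonoidHom.add_apply, h₁, h₂]; ring
  | tmul a p =>
    induction F' with
    | zero => simp
    | add F₁ F₂ h₁ h₂ => simp only [mul_add, add_mul, map_add, AddMonoidHom.add_apply, h₁, h₂]; ring
    | tmul a' p' =>
      induction G with
      | zero => simp
      | add G₁ G₂ h₁ h₂ => simp only [mul_add, map_add, h₁, h₂]; ring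
      | tmul b q =>
        simp only [extBracketHom_apply, Algebra.TensorProduct.tmul_mul_tmul, extBracket_tmul,
          bracket_mul_left, leftVar_tmul, one_mul, TensorProduct.add_tmul, mul_comm p' p]

lemma extBracketHom_deriv (F : CoordRing Q ⊗[ℂ] RatFunc ℂ) :
    IsDerivAlong (rightVar Q) (extBracketHom Q F) := by
  intro G G'
  induction G with
  | zero => simp
  | add G₁ G₂ h₁ h₂ => simp only [add_mul, map_add, h₁, h₂]; ring
  | tmul b q =>
    induction G' with
    | zero => simp
    | add G₁ G₂ h₁ h₂ => simp only [mul_add, add_mul, map_add, h₁, h₂]; ring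
    | tmul b' q' =>
      induction F with
      | zero => simp
      | add F₁ F₂ h₁ h₂ => simp only [mul_add, map_add, AddMonoidHom.add_apply, h₁, h₂]; ring
      | tmul a p =>
        simp only [extBracketHom_apply, Algebra.TensorProduct.tmul_mul_tmul, extBracket_tmul,
          bracket_mul_right, rightVar_tmul, one_mul, TensorProduct.add_tmul, mul_comm q' q]

/-- `bracket` as a biadditive map. -/
def bracketAdd (Q : DimQuiver) : CoordRing Q →+ CoordRing Q →+ CoordRing Q :=
  AddMonoidHom.mk' (fun F => (bracketHom Q F).toAddMonoidHom) fun F F' => by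
    ext G; simp

lemma bracketAdd_apply (F G : CoordRing Q) : bracketAdd Q F G = bracket F G := rfl

lemma bracketAdd_flip_deriv (G : CoordRing Q) :
    IsDerivAlong (RingHom.id _) ((bracketAdd Q).flip G) := fun F F' => by
  simp only [AddMonoidHom.flip_apply, bracketAdd_apply, bracket_mul_left, RingHom.id_apply]

lemma bracketAdd_deriv (F : CoordRing Q) :
    IsDerivAlong (RingHom.id _) (bracketAdd Q F) := fun G G' => by
  simp only [bracketAdd_apply, bracket_mul_right, RingHom.id_apply]

end Quiver

/-! ### The Hitchin map of a star-shaped quiver -/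

section Star

variable {n r : ℕ} {len : Fin n → ℕ} {γ : (m : Fin n) → Fin (len m) → ℕ}

/-- The residues satisfy the commutation relations of `⨁ m, gl(r)`. -/
lemma bracket_residue (m m' : Fin n) (a b c d : Fin r) :
    bracket (residue r len γ m a b) (residue r len γ m' c d) =
      if m = m' then (if b = c then residue r len γ m a d else 0)
        - (if a = d then residue r len γ m c b else 0) else 0 := by
  have hzero : ∀ F : CoordRing (starQuiver n r len γ), bracket 0 F = 0 := fun F => by
    simpa using bracket_C_left 0 F
  have hzero' : ∀ F : CoordRing (starQuiver n r len γ), bracket F 0 = 0 := fun F => by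
    simpa using bracket_C_right 0 F
  by_cases hm : 0 < len m
  swap
  · simp [residue, hm, hzero]
  by_cases hm' : 0 < len m'
  swap
  · have : m ≠ m' := fun h => hm' (h ▸ hm)
    simp [residue, hm', hzero', this]
  by_cases h : m = m'
  · subst h
    simp only [residue, hm, dif_pos, if_true]
    exact bracket_fwd_mul_bwd (innerArr r len γ m hm) a b c d
  · rw [if_neg h]
    simp only [residue, hm, hm', dif_pos]
    exact bracket_fwd_mul_bwd_of_ne (e := innerArr r len γ m hm) (e' := innerArr r len γ m' hm')
      (fun e => h (congrArg Sigma.fst e)) a b c d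

lemma bracket_higgsAt (x : Fin n → ℂ) (z w : ℂ) (a b c d : Fin r) :
    bracket (higgsAt r len γ x z a b) (higgsAt r len γ x w c d) =
      ∑ m, ((z - x m)⁻¹ * (w - x m)⁻¹) • ((if b = c then residue r len γ m a d else 0)
        - (if a = d then residue r len γ m c b else 0)) := by
  simp only [higgsAt, Matrix.sum_apply, Matrix.smul_apply, bracket_sum_left, bracket_sum_right,
    bracket_smul_left, bracket_smul_right, bracket_residue, smul_ite, smul_zero,
    Finset.sum_ite_eq', Finset.mem_univ, if_true, mul_smul]
  exact Finset.sum_congr rfl fun m _ => smul_comm _ _ _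

lemma extBracket_higgs (x : Fin n → ℂ) (a b c d : Fin r) :
    extBracket (higgs r len γ x a b) (higgs r len γ x c d) =
      ∑ m, ((if b = c then residue r len γ m a d else 0)
        - (if a = d then residue r len γ m c b else 0)) ⊗ₜ
          ((RatFunc.X - RatFunc.C (x m))⁻¹ ⊗ₜ (RatFunc.X - RatFunc.C (x m))⁻¹) := by
  simp only [← extBracketHom_apply, higgs, Matrix.sum_apply, Matrix.map_apply, map_sum,
    AddMonoidHom.finsetSum_apply]
  refine Finset.sum_congr rfl fun m _ => ?_
  simp only [extBracketHom_apply, extBracket_tmul, bracket_residue]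
  rw [Finset.sum_eq_single m]
  · simp
  · intro m' _ h
    simp [h]
  · simp

/-- The partial fraction identity `(w - z) / ((z - c) (w - c)) = 1 / (z - c) - 1 / (w - c)`. -/
lemma X_sub_X_mul_tmul (c : ℂ) :
    ((1 : RatFunc ℂ) ⊗ₜ[ℂ] (RatFunc.X : RatFunc ℂ) - RatFunc.X ⊗ₜ 1) *
      ((RatFunc.X - RatFunc.C c)⁻¹ ⊗ₜ (RatFunc.X - RatFunc.C c)⁻¹) =
    (RatFunc.X - RatFunc.C c)⁻¹ ⊗ₜ 1 - 1 ⊗ₜ (RatFunc.X - RatFunc.C c)⁻¹ := by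
  have h0 : (RatFunc.X - RatFunc.C c : RatFunc ℂ) ≠ 0 := by
    have := RatFunc.algebraMap_ne_zero (K := ℂ) (Polynomial.X_sub_C_ne_zero c)
    simpa using this
  set p : RatFunc ℂ := (RatFunc.X - RatFunc.C c)⁻¹ with hp
  have h1 : RatFunc.X * p = 1 + c • p := by
    rw [RatFunc.smul_eq_C_mul]
    have : (RatFunc.X - RatFunc.C c) * p = 1 := mul_inv_cancel₀ h0
    linear_combination this
  simp only [sub_mul, Algebra.TensorProduct.tmul_mul_tmul, one_mul, h1, TensorProduct.tmul_add,
    TensorProduct.add_tmul, TensorProduct.tmul_smul, TensorProduct.smul_tmul']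
  ring

/-- The classical `r`-matrix relation
`(w - z) {φ(z)_ab, φ(w)_cd} = δ_bc (φ(z) - φ(w))_ad - δ_ad (φ(z) - φ(w))_cb`. -/
lemma mul_extBracket_higgs (x : Fin n → ℂ) (a b c d : Fin r) :
    ((1 : CoordRing (starQuiver n r len γ)) ⊗ₜ[ℂ]
      ((1 : RatFunc ℂ) ⊗ₜ[ℂ] (RatFunc.X : RatFunc ℂ) - RatFunc.X ⊗ₜ 1)) *
      extBracketHom (starQuiver n r len γ) (higgs r len γ x a b) (higgs r len γ x c d) =
    (if b = c then ((higgs r len γ x).map (leftVar (starQuiver n r len γ)) -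
        (higgs r len γ x).map (rightVar (starQuiver n r len γ))) a d else 0) -
      (if a = d then ((higgs r len γ x).map (leftVar (starQuiver n r len γ)) -
        (higgs r len γ x).map (rightVar (starQuiver n r len γ))) c b else 0) := by
  have h1 : ∀ a d, ((higgs r len γ x).map (leftVar (starQuiver n r len γ)) -
      (higgs r len γ x).map (rightVar (starQuiver n r len γ))) a d =
      ∑ m, residue r len γ m a d ⊗ₜ[ℂ] ((RatFunc.X - RatFunc.C (x m))⁻¹ ⊗ₜ 1
        - 1 ⊗ₜ (RatFunc.X - RatFunc.C (x m))⁻¹) := by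
    intro a d
    simp only [higgs, Matrix.sub_apply, Matrix.map_apply, Matrix.sum_apply, map_sum,
      ← Finset.sum_sub_distrib]
    refine Finset.sum_congr rfl fun m _ => ?_
    rw [leftVar_tmul, rightVar_tmul, TensorProduct.tmul_sub]
  rw [extBracketHom_apply, extBracket_higgs, Finset.mul_sum]
  simp only [Algebra.TensorProduct.tmul_mul_tmul, one_mul, X_sub_X_mul_tmul, h1]
  simp only [TensorProduct.sub_tmul, Finset.sum_sub_distrib]
  congr 1 <;> split_ifs <;> simp

lemma extBracket_eq_zero_of_hasCommGrad (x : Fin n → ℂ)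
    {f g : CoordRing (starQuiver n r len γ) ⊗[ℂ] RatFunc ℂ}
    {P R : Matrix (Fin r) (Fin r) (CoordRing (starQuiver n r len γ) ⊗[ℂ] RatFunc ℂ)}
    (hf : HasCommGrad (leftVar (starQuiver n r len γ)) (higgs r len γ x) f P)
    (hg : HasCommGrad (rightVar (starQuiver n r len γ)) (higgs r len γ x) g R) :
    extBracket f g = 0 :=
  eq_zero_of_one_tmul_X_sub_X_mul_eq_zero _ <|
    mul_biderivation_eq_zero extBracketHom_flip_deriv extBracketHom_deriv hf hg _
      (mul_extBracket_higgs x)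

lemma bracket_traceAt (x : Fin n → ℂ) (t t' : ℕ) {z w : ℂ} (hz : ∀ m, z ≠ x m)
    (hw : ∀ m, w ≠ x m) : bracket (traceAt r len γ x t z) (traceAt r len γ x t' w) = 0 := by
  have hf := hasCommGrad_trace_pow (RingHom.id _) (higgsAt r len γ x z) t
  have hg := hasCommGrad_trace_pow (RingHom.id _) (higgsAt r len γ x w) t'
  -- At `z = w` there is no factor `w - z` to cancel, but the two gradients are powers of the same
  -- matrix and commute.
  by_cases hzw : z = w
  · subst hzw
    have key := mul_biderivation bracketAdd_flip_deriv bracketAdd_deriv hf hg 1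
      (∑ m, ((z - x m)⁻¹ * (z - x m)⁻¹) • residue r len γ m) fun a b c d => by
        rw [one_mul, bracketAdd_apply, bracket_higgsAt]
        simp only [Matrix.sum_apply, Matrix.smul_apply, smul_sub, Finset.sum_sub_distrib]
        congr 1 <;> split_ifs <;> simp
    rw [one_mul] at key
    refine key.trans ?_
    have hc : Commute (t • higgsAt r len γ x z ^ (t - 1)) (t' • higgsAt r len γ x z ^ (t' - 1)) :=
      (((Commute.refl _).pow_pow _ _).smul_left _).smul_right _
    simp only [RingHom.coe_id, Matrix.map_id]
    rw [hc.eq, sub_self]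
  · have key := mul_biderivation_eq_zero bracketAdd_flip_deriv bracketAdd_deriv hf hg (C (w - z))
      fun a b c d => by
        rw [bracketAdd_apply, bracket_higgsAt]
        have h1 : ∀ a d, ((higgsAt r len γ x z).map (RingHom.id _) -
            (higgsAt r len γ x w).map (RingHom.id _)) a d =
            ∑ m, ((w - z) * ((z - x m)⁻¹ * (w - x m)⁻¹)) • residue r len γ m a d := by
          intro a d
          simp only [higgsAt, RingHom.coe_id, Matrix.map_id, Matrix.sub_apply, Matrix.sum_apply,
            Matrix.smul_apply, ← Finset.sum_sub_distrib, ← sub_smul]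
          refine Finset.sum_congr rfl fun m _ => ?_
          congr 1
          have := sub_ne_zero.2 (hz m)
          have := sub_ne_zero.2 (hw m)
          field_simp
          ring
        rw [h1, h1, ← MvPolynomial.smul_eq_C_mul]
        simp only [Finset.smul_sum, smul_smul, smul_sub, Finset.sum_sub_distrib]
        congr 1 <;> split_ifs <;> simp
    rw [bracketAdd_apply, ← MvPolynomial.smul_eq_C_mul] at key
    exact (smul_eq_zero.1 key).resolve_left (sub_ne_zero.2 (Ne.symm hzw))

lemma bracket_hitchinComp (x : Fin n → ℂ) (ℓ ℓ' : (Fin r → RatFunc ℂ) →ₗ[ℂ] ℂ) :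
    bracket (hitchinComp r len γ x ℓ) (hitchinComp r len γ x ℓ') = 0 := by
  simp only [hitchinComp, bracket_sum_left, bracket_sum_right, bracket_coordAlong]
  refine Finset.sum_eq_zero fun j _ => Finset.sum_eq_zero fun j' _ => ?_
  rw [charCoeff, charCoeff, extBracket_eq_zero_of_hasCommGrad x
    (hasCommGrad_charpoly_coeff _ _ _) (hasCommGrad_charpoly_coeff _ _ _), map_zero]

lemma invBracket_hitchinInv (x : Fin n → ℂ) (ℓ ℓ' : (Fin r → RatFunc ℂ) →ₗ[ℂ] ℂ) :
    invBracket (hitchinInv r len γ x ℓ) (hitchinInv r len γ x ℓ') = 0 := by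
  refine Subtype.ext ?_
  rw [invBracket_eq _ _ (hitchinComp r len γ x ℓ) (hitchinComp r len γ x ℓ') rfl rfl,
    bracket_hitchinComp, map_zero]
  rfl

end Star

end QuiverVariety

end

open QuiverVariety in
theorem proposition4 (n r : ℕ) (len : Fin n → ℕ) (γ : (m : Fin n) → Fin (len m) → ℕ)
    (x : Fin n → ℂ) (hx : Function.Injective x) :
    (∀ t t' : ℕ, extBracket (traceFun r len γ x t) (traceFun r len γ x t') = 0) ∧
    (∀ (t t' : ℕ) (z w : ℂ), (∀ m, z ≠ x m) → (∀ m, w ≠ x m) →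
      bracket (traceAt r len γ x t z) (traceAt r len γ x t' w) = 0) ∧
    (∀ ℓ ℓ' : (Fin r → RatFunc ℂ) →ₗ[ℂ] ℂ,
      bracket (hitchinComp r len γ x ℓ) (hitchinComp r len γ x ℓ') = 0 ∧
      ∀ F G : CoordRing (starQuiver n r len γ),
        toFibre F = toFibre (hitchinComp r len γ x ℓ) →
        toFibre G = toFibre (hitchinComp r len γ x ℓ') →
        toFibre (bracket F G) = 0) ∧
    (∀ (θ : (starQuiver n r len γ).Vert → ℤ) (ℓ ℓ' : (Fin r → RatFunc ℂ) →ₗ[ℂ] ℂ),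
      sectionBracket θ ⊤ (hitchinSection r len γ x θ ℓ) (hitchinSection r len γ x θ ℓ') = 0) ∧
    (∀ ℓ ℓ' : (Fin r → RatFunc ℂ) →ₗ[ℂ] ℂ,
      invBracket (hitchinInv r len γ x ℓ) (hitchinInv r len γ x ℓ') = 0) := by
  refine ⟨fun t t' => extBracket_eq_zero_of_hasCommGrad x (hasCommGrad_trace_pow _ _ t)
      (hasCommGrad_trace_pow _ _ t'), fun t t' z w hz hw => bracket_traceAt x t t' hz hw,
    fun ℓ ℓ' => ⟨bracket_hitchinComp x ℓ ℓ', fun F G hF hG => ?_⟩,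
    fun θ ℓ ℓ' => sectionBracket_proj θ _ _ (invBracket_hitchinInv x ℓ ℓ'),
    invBracket_hitchinInv x⟩
  rw [← invBracket_eq (hitchinInv r len γ x ℓ) (hitchinInv r len γ x ℓ') F G hF hG,
    invBracket_hitchinInv]
  rfl
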